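/- **Setting.** Let $p,q\ge 1$, $d=\max\{p,q\}$, and let $f:\mathbb R^{p}\times\mathbb R^{q}\to\mathbb R$ be twice differentiable, with $f(x,\cdot)$ $\mu$-strongly concave for every $x$ ($\mu>0$), $\nabla f$ $\ell$-Lipschitz and $\nabla^2 f$ $\rho$-Lipschitz ($\rho>0$) for the Euclidean and spectral norms, and let $\varphi(x)=\max_{y}f(x,y)$ be bounded below. Put $\varphi^*=\inf\varphi$, $y^*(x)=\arg\max_y f(x,y)$, $\kappa=\ell/\mu$, $\bar\rho=4\sqrt2\,\kappa^3\rho$, and, for a starting point $x_0$, $\Delta=\varphi(x_0)-\varphi^*$. A point $\hat x$ is an $(\epsilon,\tau)$-SOSP of $\varphi$ if $\varphi$ is twice differentiable at $\hat x$, $\|\nabla\varphi(\hat x)\|\le\epsilon$ and $\lambda_{\min}(\nabla^2\varphi(\hat x))\ge-\tau$. **Algorithm (LMCN)** with input $x_0$, $T$, $(K_t)$, accuracy $\delta>0$, $m$, $M$. Set $y_{-1}=0$. For $t=0,\dots,T-1$: 1. $y_t$ is the result of $K_t$ steps of accelerated gradient descent on $h=-f(x_t,\cdot)$ from $y_{t-1}$,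 that is, of $z_{k+1}=\tilde z_k-\frac1\ell\nabla h(\tilde z_k)$, $\tilde z_{k+1}=z_{k+1}+\frac{\sqrt\kappa-1}{\sqrt\kappa+1}(z_{k+1}-z_k)$ with $\tilde z_0=z_0=y_{t-1}$. 2. $g_t=\nabla_xf(x_t,y_t)$; if $m\mid t$, set $\tilde x=x_t$ and $\tilde H=\big(\nabla^2_{xx}f-\nabla^2_{xy}f[\nabla^2_{yy}f]^{-1}\nabla^2_{yx}f\big)(x_t,y_t)$. 3. $s_t$ is any global minimizer of $s\mapsto g_t^\top s+\frac12s^\top\tilde Hs+\frac M6\|s\|^3$, and $x_{t+1}=x_t+s_t$. 4. Stop if $\delta\ge\frac1M\big(\frac{288}{287}\big)^2\big(\frac{M+2\bar\rho}{\sqrt2}\|s_t\|+\bar\rho\|\tilde x-x_t\|\big)^2$. The output $\hat x$ is the last point $x_{t+1}$ computed. **Cost.** Every evaluation of $\nabla_xf$ or $\nabla_yf$ at a point costs $N>0$, and every evaluation of one of the four second-order blocks of $f$ at a point costs $dN$. **Parameters.** $m$ is an integer with $|m-(d/\sqrt\kappa+1)|\le1$. With $\tilde\epsilon=\min\{\delta/(576\ell),\sqrt{M\delta}/(288\rho)\}$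 and $\lceil u\rceil$ read as $0$ for $u\le 0$ (also when $u=2\sqrt\kappa\log 0=-\infty$), $$K_0=\Big\lceil2\sqrt\kappa\log\Big(\tfrac{\sqrt{\kappa+1}}{\tilde\epsilon}\|y^*(x_0)\|\Big)\Big\rceil,\qquad K_t=\Big\lceil2\sqrt\kappa\log\Big(\tfrac{\sqrt{\kappa+1}}{\tilde\epsilon}\big(\tilde\epsilon+\kappa\|x_t-x_{t-1}\|\big)\Big)\Big\rceil\quad(t\ge1).$$ **Theorem 4.7.** There is an absolute constant $c>0$ such that for every $C\ge c$ there is $a_0\in(0,1]$, depending only on $C$, and for every $a\in(0,1]$ there is $B>0$, depending only on $C$ and $a$, such that the following holds for all $p,q,f,\mu,\ell,\rho,x_0,N$ as above and all $\epsilon>0$. Run LMCN with accuracy $\delta=a\epsilon$, with $m$ and $K_t$ as above, any $M$ with $c\,m\bar\rho\le M\le C\,m\bar\rho$, and any integer $T>c\,\Delta\sqrt M\,\delta^{-3/2}$. Such runs exist, and for every such run: * $\hat x$ is an $(a\epsilon,\sqrt{Ma\epsilon})$-SOSP of $\varphi$ (for $a=1$: an $(\epsilon,\sqrt{M\epsilon})$-SOSP);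 * if $a\le a_0$, then $\hat x$ is an $\big(\epsilon,\kappa^{1.25}\sqrt{\max\{d,\sqrt\kappa\}\,\rho\,\epsilon}\big)$-SOSP of $\varphi$; for $d\ge\sqrt\kappa$ this is an $(\epsilon,\kappa^{1.25}\sqrt{d\rho\epsilon})$-SOSP; * the computational cost of the run is at most $$B\,N\Big(\Delta\,(\kappa^{0.5}+\kappa^{0.25}d^{0.5})\,\kappa^{1.5}\rho^{0.5}\epsilon^{-1.5}+\kappa^{0.5}+d\Big)\,\log\Big(2+\kappa+\frac{\ell^2}{\rho\epsilon}+\frac{\ell\|y^*(x_0)\|}{\epsilon}+\frac{\rho\|y^*(x_0)\|^2}{\epsilon}\Big),$$ that is, $\tilde O\big(N(\kappa^{0.5}+\kappa^{0.25}d^{0.5})\kappa^{1.5}\rho^{0.5}\epsilon^{-1.5}\big)$ as $\epsilon\to0$, for fixed $\Delta>0$. Moreover $\kappa^{0.5}+\kappa^{0.25}d^{0.5}\le\frac32(\kappa^{0.5}+d)$, so this bound is, up to a constant, never worse than the bound $\tilde O\big(N(\kappa^{0.5}+d)\kappa^{1.5}\rho^{0.5}\epsilon^{-1.5}\big)$ for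 MCN. -/

import Mathlib

open Set Filter Topology

namespace LMCN

noncomputable section

/-- `ℝⁿ` with the Euclidean norm. -/
abbrev Vec (n : ℕ) : Type := EuclideanSpace ℝ (Fin n)

/-- `X × Y` with the Euclidean norm `‖(x, y)‖² = ‖x‖² + ‖y‖²`. -/
abbrev Joint (X Y : Type) : Type := WithLp 2 (X × Y)

/-- The point `(x, y)` of the joint space. -/
def pair {X Y : Type} (x : X) (y : Y) : Joint X Y := WithLp.toLp 2 (x, y)

section General

/- The definitions are written for complete real inner product spaces `X`, `Y`; they are used for
`X = ℝ^p` and `Y = ℝ^q`. -/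
variable {X Y : Type} [NormedAddCommGroup X] [InnerProductSpace ℝ X] [CompleteSpace X]
  [NormedAddCommGroup Y] [InnerProductSpace ℝ Y] [CompleteSpace Y]

/-- The Hessian, as the derivative of the gradient; its operator norm is the spectral norm. -/
def hessian (h : X → ℝ) (x : X) : X →L[ℝ] X := fderiv ℝ (gradient h) x

/-- `∇ₓ f(x, y)`. -/
def gradX (f : Joint X Y → ℝ) (x : X) (y : Y) : X :=
  gradient (fun x' => f (pair x' y)) x

/-- `∇_y f(x, y)`. -/
def gradY (f : Joint X Y → ℝ) (x : X) (y : Y) : Y :=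
  gradient (fun y' => f (pair x y')) y

/-- The block `∇²ₓₓ f(x, y)`. -/
def hessXX (f : Joint X Y → ℝ) (x : X) (y : Y) : X →L[ℝ] X :=
  fderiv ℝ (fun x' => gradX f x' y) x

/-- The block `∇²_{xy} f(x, y)` (upper right block of the Hessian). -/
def hessXY (f : Joint X Y → ℝ) (x : X) (y : Y) : Y →L[ℝ] X :=
  fderiv ℝ (fun y' => gradX f x y') y

/-- The block `∇²_{yx} f(x, y)` (lower left block of the Hessian). -/
def hessYX (f : Joint X Y → ℝ) (x : X) (y : Y) : X →L[ℝ] Y :=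
  fderiv ℝ (fun x' => gradY f x' y) x

/-- The block `∇²_{yy} f(x, y)`. -/
def hessYY (f : Joint X Y → ℝ) (x : X) (y : Y) : Y →L[ℝ] Y :=
  fderiv ℝ (fun y' => gradY f x y') y

/-- `H(x; y) = ∇²ₓₓ f - ∇²_{xy} f [∇²_{yy} f]⁻¹ ∇²_{yx} f`. -/
def schurHessian (f : Joint X Y → ℝ) (x : X) (y : Y) : X →L[ℝ] X :=
  hessXX f x y - (hessXY f x y).comp ((hessYY f x y).inverse.comp (hessYX f x y))

/-- `φ(x) = max_y f(x, y)`. -/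
def primal (f : Joint X Y → ℝ) (x : X) : ℝ := ⨆ y : Y, f (pair x y)

open Classical in
/-- `y*(x)`, a maximizer of `f(x, ·)` (there is exactly one under strong concavity). -/
def yStar (f : Joint X Y → ℝ) (x : X) : Y :=
  Classical.epsilon fun y => ∀ y' : Y, f (pair x y') ≤ f (pair x y)

/-- The standing assumptions on `f` and `φ = max_y f(·, y)`. -/
structure Assumptions (f : Joint X Y → ℝ) (μ ℓ ρ : ℝ) : Prop where
  differentiable : Differentiable ℝ f
  twice_differentiable : Differentiable ℝ (gradient f)
  strongly_concave : ∀ x : X, StrongConcaveOn univ μ fun y : Y => f (pair x y)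
  gradient_lipschitz : ∀ z w : Joint X Y, ‖gradient f z - gradient f w‖ ≤ ℓ * ‖z - w‖
  hessian_lipschitz : ∀ z w : Joint X Y, ‖hessian f z - hessian f w‖ ≤ ρ * ‖z - w‖
  bddBelow : BddBelow (range (primal f))

/-- `x` is an `(ε, τ)`-second-order stationary point of `φ`: `φ` is twice differentiable at `x`,
`‖∇φ(x)‖ ≤ ε`, and the smallest eigenvalue of `∇²φ(x)` is at least `-τ`. -/
structure IsSOSP (φ : X → ℝ) (ε τ : ℝ) (x : X) : Prop where
  differentiable : ∀ᶠ z in 𝓝 x, DifferentiableAt ℝ φ z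
  twice_differentiable : DifferentiableAt ℝ (gradient φ) x
  gradient_le : ‖gradient φ x‖ ≤ ε
  lambdaMin_ge : ∃ lam : ℝ,
    IsLeast {c : ℝ | Module.End.HasEigenvalue (hessian φ x : X →ₗ[ℝ] X) c} lam ∧ -τ ≤ lam

/-- State of accelerated gradient descent: the iterate `z_k`, the extrapolated point `z̃_k`, and
the number of gradients evaluated so far. -/
structure AGDState (X : Type) where
  z : X
  zTilde : X
  calls : ℕ

/-- One step of accelerated gradient descent on `h` (one gradient evaluation). -/
def agdStep (h : X → ℝ) (η θ : ℝ) (a : AGDState X) : AGDState X :=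
  let z' := a.zTilde - η • gradient h a.zTilde
  { z := z', zTilde := z' + θ • (z' - a.z), calls := a.calls + 1 }

/-- `AGD(h, z₀, K, η, θ)`: the state after `K` steps. -/
def agd (h : X → ℝ) (z₀ : X) (K : ℕ) (η θ : ℝ) : AGDState X :=
  (agdStep h η θ)^[K] { z := z₀, zTilde := z₀, calls := 0 }

/-- The input of the lazy minimax cubic Newton method. -/
structure Input (X : Type) where
  x₀ : X
  T : ℕ
  K : ℕ → ℕ
  κ₁ : ℝ
  ℓ₁ : ℝ
  ε : ℝ
  m : ℕ
  M : ℝ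
  ρbar : ℝ

/-- State of the method at the start of iteration `t`: `x_t`, `y_{t-1}`, the snapshot point `x̃`
and snapshot matrix `H̃`, and the numbers of first-order queries (each of `∇ₓ f`, `∇_y f` at a
point) and of second-order queries (each of the Hessian blocks at a point) made so far. -/
structure State (X Y : Type) [NormedAddCommGroup X] [InnerProductSpace ℝ X] where
  x : X
  y : Y
  xTilde : X
  HTilde : X →L[ℝ] X
  firstCalls : ℕ
  secondCalls : ℕ

/-- Initial state, `y_{-1} = 0`; the snapshot entries are overwritten in iteration `0`. -/
def initState (x₀ : X) : State X Y :=
  { x := x₀, y := 0, xTilde := x₀, HTilde := 0, firstCalls := 0, secondCalls := 0 }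

/-- The cubic model `gᵀs + sᵀHs/2 + M‖s‖³/6`. -/
def cubicModel (g : X) (H : X →L[ℝ] X) (M : ℝ) (s : X) : ℝ :=
  inner ℝ g s + (1 / 2) * inner ℝ s (H s) + (M / 6) * ‖s‖ ^ 3

/-- The call of accelerated gradient descent in iteration `t`, on `-f(x_t, ·)` from `y_{t-1}`. -/
def innerLoop (f : Joint X Y → ℝ) (I : Input X) (t : ℕ) (S : State X Y) : AGDState Y :=
  agd (fun y => -f (pair S.x y)) S.y (I.K t) (1 / I.ℓ₁) ((√I.κ₁ - 1) / (√I.κ₁ + 1))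

/-- `S'` is a possible result of iteration `t` from `S`; the only freedom is the choice of a global
minimizer `s = x_{t+1} - x_t` of the cubic model. A new snapshot, made when `m` divides `t`, queries
the four Hessian blocks. -/
structure IsIteration (f : Joint X Y → ℝ) (I : Input X) (t : ℕ) (S S' : State X Y) :
    Prop where
  y_eq : S'.y = (innerLoop f I t S).z
  xTilde_eq : S'.xTilde = if t % I.m = 0 then S.x else S.xTilde
  HTilde_eq : S'.HTilde = if t % I.m = 0 then schurHessian f S.x S'.y else S.HTilde
  argmin : ∀ s : X, cubicModel (gradX f S.x S'.y) S'.HTilde I.M (S'.x - S.x) ≤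
    cubicModel (gradX f S.x S'.y) S'.HTilde I.M s
  firstCalls_eq : S'.firstCalls = S.firstCalls + (innerLoop f I t S).calls + 1
  secondCalls_eq : S'.secondCalls = S.secondCalls + if t % I.m = 0 then 4 else 0

/-- The stopping test at the end of the iteration that led from `S` to `S'`. -/
def Stops (I : Input X) (S S' : State X Y) : Prop :=
  I.ε ≥ (1 / I.M) * (288 / 287) ^ 2 *
    ((I.M + 2 * I.ρbar) / √2 * ‖S'.x - S.x‖ + I.ρbar * ‖S'.xTilde - S.x‖) ^ 2

/-- `σ 0, …, σ n` are the states of a complete run that executes exactly `n` iterations: it ends at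
the first iteration that passes the stopping test, or after `T` iterations. The output is
`(σ n).x`. -/
structure IsRun (f : Joint X Y → ℝ) (I : Input X) (σ : ℕ → State X Y) (n : ℕ) :
    Prop where
  init : σ 0 = initState I.x₀
  pos : 1 ≤ n
  le : n ≤ I.T
  iteration : ∀ t < n, IsIteration f I t (σ t) (σ (t + 1))
  continues : ∀ t, t + 1 < n → ¬ Stops I (σ t) (σ (t + 1))
  ends : n = I.T ∨ Stops I (σ (n - 1)) (σ n)

/-- The computational cost of a run that ends in state `S`: a first-order query costs `N`, a
second-order query costs `d N`. -/
def cost (N d : ℝ) (S : State X Y) : ℝ := N * S.firstCalls + d * N * S.secondCalls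

/-- `ε̃ = min {ε / (576 ℓ), √(M ε) / (288 ρ)}`. -/
def innerAccuracy (ℓ ρ M ε : ℝ) : ℝ := min (ε / (576 * ℓ)) (√(M * ε) / (288 * ρ))

/-- The inner iteration numbers `K_t`, `t < n`, of a run `σ`, for the inner accuracy `e`. -/
structure IsSchedule (f : Joint X Y → ℝ) (κ e : ℝ) (K : ℕ → ℕ) (σ : ℕ → State X Y)
    (n : ℕ) : Prop where
  zero : K 0 = ⌈2 * √κ * Real.log (√(κ + 1) / e * ‖yStar f (σ 0).x‖)⌉₊
  succ : ∀ t, t + 1 < n → K (t + 1) =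
    ⌈2 * √κ * Real.log (√(κ + 1) / e * (e + κ * ‖(σ (t + 1)).x - (σ t).x‖))⌉₊

end General

end

end LMCN

/-! The method is an inexact cubic Newton method for φ with a lazily updated Hessian. Everything is
measured in the unit u = √(δ/M), for which δ = M u² and √(Mδ) = M u.

Reduction to φ. By Danskin's theorem ∇φ(x) = ∇ₓf(x, y*(x)), and implicit differentiation of ∇_y f(x,
y*(x)) = 0 shows that ∇²φ(x) is the Schur complement at y*(x). The Schur complement is
4κ²ρ-Lipschitz and x ↦ (x, y*(x)) is √2κ-Lipschitz, so ∇²φ is ρ̄-Lipschitz. Accelerated gradient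
descent contracts a Lyapunov function by 1 - 1/√κ. Warm starting at y_{t-1}, whose distance to
y*(x_t) is at most ε̃ + κ‖x_t - x_{t-1}‖, the K_t steps reach accuracy ε̃ (`Setting.accuracy`).
Hence g_t errs by at most M u²/576 and H̃ by at most M u/1000, relative to ∇φ(x_t) and ∇²φ(x̃).

Dichotomy. Let r = ‖s_t‖ and b = ‖x̃ - x_t‖. If the test passes, the optimality conditions of the
cubic model and Taylor's formula make x_{t+1} second-order stationary (`stationary_of_stop`). If it
fails, φ changes by at most M(-(9/50) r³ + 51 (ρ̄b/M)³), and u³ ≤ 4r³ + 32(ρ̄b/M)³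
(`descent_of_not_stop`). Since b is bounded by a sum of fewer than m earlier step lengths, Σ b³ ≤ m³
Σ r³ (`sum_cube_window_le`). As mρ̄ ≤ M/10000, the effect of the old snapshot is absorbed.
Telescoping gives M Σ r³ ≤ 8Δ and at most 40W failures, where W = Δ/(M u³) = Δ√M δ^(-3/2). A larger
T therefore forces the test to pass.

Cost. K_{t+1} is of order √κ times a logarithm of the step length r_t. That logarithm splits into a
fixed part and at most 1 + r_t³/u³, and these cubes sum to at most 8W, so the inner loops cost O(√κ
W) up to the logarithmic factor and the first call. Snapshots occur every m iterations at price 4dN,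
and d/m ≤ √κ, so they fit the same bound up to an additive 4dN. Finally M = O(mρ̄) turns √κ W into
the stated expression. -/

namespace LMCN

/-! ### First-order inequalities for smooth and for strongly concave functions. -/

section Smooth

variable {E : Type*} [NormedAddCommGroup E] [InnerProductSpace ℝ E] [CompleteSpace E]

/-- The derivative of a function along a line, in terms of its gradient. -/
theorem hasDerivAt_line {h : E → ℝ} {g : E → E} (hg : ∀ x, HasGradientAt h (g x) x)
    (x v : E) (t : ℝ) :
    HasDerivAt (fun t : ℝ => h (x + t • v)) (inner ℝ (g (x + t • v)) v) t := by
  have h1 : HasDerivAt (fun t : ℝ => x + t • v) v t := by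
    simpa using ((hasDerivAt_id t).smul_const v).const_add x
  exact ((hg (x + t • v)).hasFDerivAt.comp_hasDerivAt t h1).congr_deriv (by simp)

/-- The descent lemma for a function with Lipschitz gradient. -/
theorem le_quadratic_of_lipschitz_gradient {h : E → ℝ} {g : E → E} {ℓ : ℝ}
    (hg : ∀ x, HasGradientAt h (g x) x) (hl : ∀ x y, ‖g x - g y‖ ≤ ℓ * ‖x - y‖) (x v : E) :
    h (x + v) ≤ h x + inner ℝ (g x) v + ℓ / 2 * ‖v‖ ^ 2 := by
  -- ψ is h along the segment minus its quadratic model, up to a constant. The Lipschitz bound makes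
  -- ψ' nonpositive on (0, 1), so ψ 1 ≤ ψ 0.
  set ψ : ℝ → ℝ := fun t => h (x + t • v) - t * inner ℝ (g x) v - ℓ / 2 * ‖v‖ ^ 2 * t ^ 2 with hψ
  have hd : ∀ t, HasDerivAt ψ (inner ℝ (g (x + t • v)) v - inner ℝ (g x) v
      - ℓ / 2 * ‖v‖ ^ 2 * (2 * t)) t := by
    intro t
    exact (((hasDerivAt_line hg x v t).sub ((hasDerivAt_id t).mul_const (inner ℝ (g x) v))).sub
      ((hasDerivAt_pow 2 t).const_mul (ℓ / 2 * ‖v‖ ^ 2))).congr_deriv (by simp)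
  have hanti : AntitoneOn ψ (Icc 0 1) := by
    refine antitoneOn_of_hasDerivWithinAt_nonpos (convex_Icc 0 1)
      (fun t _ => (hd t).continuousAt.continuousWithinAt)
      (fun t _ => (hd t).hasDerivWithinAt) ?_
    intro t ht
    rw [interior_Icc] at ht
    have h1 : inner ℝ (g (x + t • v) - g x) v ≤ ℓ * (t * ‖v‖) * ‖v‖ := by
      refine (real_inner_le_norm _ _).trans ?_
      gcongr
      refine (hl _ _).trans ?_
      rw [add_sub_cancel_left, norm_smul, Real.norm_of_nonneg ht.1.le]
    rw [inner_sub_left] at h1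
    nlinarith
  have := hanti (left_mem_Icc.2 zero_le_one) (right_mem_Icc.2 zero_le_one) zero_le_one
  simp [hψ] at this
  linarith

/-- The first-order characterization of convexity, in the direction used for lower bounds. -/
theorem add_inner_le_of_convexOn {h : E → ℝ} (hc : ConvexOn ℝ univ h) {x g : E}
    (hg : HasGradientAt h g x) (y : E) : h x + inner ℝ g (y - x) ≤ h y := by
  have hd : HasDerivAt (fun t : ℝ => h (x + t • (y - x))) (inner ℝ g (y - x)) 0 := by
    have h1 : HasDerivAt (fun t : ℝ => x + t • (y - x)) (y - x) 0 := by
      simpa using ((hasDerivAt_id (0 : ℝ)).smul_const (y - x)).const_add x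
    have h2 : HasFDerivAt h (InnerProductSpace.toDual ℝ E g) (x + (0 : ℝ) • (y - x)) := by
      simpa using hg.hasFDerivAt
    exact (h2.comp_hasDerivAt (0 : ℝ) h1).congr_deriv (by simp)
  have hconv : ConvexOn ℝ univ (fun t : ℝ => h (x + t • (y - x))) := by
    have := hc.comp_affineMap (AffineMap.lineMap x y : ℝ →ᵃ[ℝ] E)
    refine this.congr (fun t _ => ?_)
    simp [AffineMap.lineMap_apply, add_comm]
  have := hconv.le_slope_of_hasDerivAt (mem_univ 0) (mem_univ 1) zero_lt_one hd
  simp [slope_def_field] at this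
  linarith

/-- The first-order characterization of strong concavity. -/
theorem StrongConcave.le_quadratic {h : E → ℝ} {μ : ℝ} (hc : StrongConcaveOn univ μ h) {x g : E}
    (hg : HasGradientAt h g x) (y : E) :
    h y ≤ h x + inner ℝ g (y - x) - μ / 2 * ‖y - x‖ ^ 2 := by
  have h1 := (strongConcaveOn_iff_convex.1 hc).neg
  have h2 : HasGradientAt (fun z : E => ‖z‖ ^ 2) ((2 : ℝ) • x) x := by
    rw [hasGradientAt_iff_hasFDerivAt]
    refine (hasStrictFDerivAt_norm_sq x).hasFDerivAt.congr_fderiv ?_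
    ext v
    simp [two_smul]
  have h3 : HasGradientAt (-fun z => h z + μ / 2 * ‖z‖ ^ 2) (-(g + (μ / 2) • (2 : ℝ) • x)) x := by
    rw [hasGradientAt_iff_hasFDerivAt]
    refine (hg.hasFDerivAt.add (h2.hasFDerivAt.const_mul (μ / 2))).neg.congr_fderiv ?_
    ext v
    simp
  have h6 := add_inner_le_of_convexOn h1 h3 y
  have h7 : ‖y - x‖ ^ 2 = ‖y‖ ^ 2 - 2 * inner ℝ y x + ‖x‖ ^ 2 := norm_sub_sq_real y x
  simp only [Pi.neg_apply, inner_neg_left, inner_add_left, inner_smul_left, inner_sub_right,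
    real_inner_self_eq_norm_sq, RCLike.conj_to_real] at h6 ⊢
  rw [h7]
  rw [real_inner_comm x y]
  nlinarith

end Smooth

/-! ### Linear convergence of accelerated gradient descent. -/

section AGD

variable {Y : Type} [NormedAddCommGroup Y] [InnerProductSpace ℝ Y] [CompleteSpace Y]

theorem agd_succ (h : Y → ℝ) (z₀ : Y) (K : ℕ) (η θ : ℝ) :
    agd h z₀ (K + 1) η θ = agdStep h η θ (agd h z₀ K η θ) := by
  simp only [agd, Function.iterate_succ_apply']

theorem agd_calls (h : Y → ℝ) (z₀ : Y) (K : ℕ) (η θ : ℝ) : (agd h z₀ K η θ).calls = K := by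
  induction K with
  | zero => rfl
  | succ K ih => rw [agd_succ]; simp [agdStep, ih]

/-- The Lyapunov function of accelerated gradient descent, with `s = √κ` and `w` the minimizer. -/
noncomputable def agdPotential (h : Y → ℝ) (μ s : ℝ) (w : Y) (a : AGDState Y) : ℝ :=
  h a.z - h w + μ / 2 * ‖a.zTilde + s • (a.zTilde - a.z) - w‖ ^ 2

/-- The Lyapunov function contracts by the factor `1 - 1 / √κ` in each step. -/
theorem agdPotential_step {h : Y → ℝ} {g : Y → Y} {μ ℓ s : ℝ} (hμ : 0 < μ) (hs : 1 ≤ s)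
    (hℓ : ℓ = μ * s ^ 2)
    (hg : ∀ x, HasGradientAt h (g x) x) (hl : ∀ x y, ‖g x - g y‖ ≤ ℓ * ‖x - y‖)
    (hc : ∀ x y, h x + inner ℝ (g x) (y - x) + μ / 2 * ‖y - x‖ ^ 2 ≤ h y) (w : Y)
    (a : AGDState Y) :
    agdPotential h μ s w (agdStep h (1 / ℓ) ((s - 1) / (s + 1)) a) ≤
      (1 - 1 / s) * agdPotential h μ s w a := by
  obtain ⟨z, x, k⟩ := a
  have hs0 : 0 < s := by linarith
  have hℓ0 : 0 < ℓ := by rw [hℓ]; positivity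
  have hgx : gradient h x = g x := (hg x).gradient
  set G := g x with hG
  set b := x - z with hb
  set e := x - w with he
  have h1 := le_quadratic_of_lipschitz_gradient hg hl x (-((1 / ℓ) • G))
  have h2 := hc x z
  have h3 := hc x w
  have hz : z - x = -b := by simp [hb]
  have hw : w - x = -e := by simp [he]
  rw [hz, norm_neg, inner_neg_right] at h2
  rw [hw, norm_neg, inner_neg_right] at h3
  rw [inner_neg_right, norm_neg, inner_smul_right, norm_smul, real_inner_self_eq_norm_sq,
    ← sub_eq_add_neg, mul_pow, Real.norm_eq_abs, sq_abs] at h1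
  have h1' : h (x - (1 / ℓ) • G) ≤ h x - ‖G‖ ^ 2 / (2 * ℓ) := by
    refine h1.trans (le_of_eq ?_)
    field_simp
    ring
  -- The new auxiliary point is z' + (s + 1)θ(z' - z), and θ = (s - 1)/(s + 1) turns the factor into
  -- s - 1.
  have hv : (x - (1 / ℓ) • G + ((s - 1) / (s + 1)) • (x - (1 / ℓ) • G - z)) +
      s • ((x - (1 / ℓ) • G + ((s - 1) / (s + 1)) • (x - (1 / ℓ) • G - z)) - (x - (1 / ℓ) • G)) - w
      = e + (s - 1) • b - (s / ℓ) • G := by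
    have hs1 : s + 1 ≠ 0 := by positivity
    simp only [hb, he]
    match_scalars <;> field_simp <;> ring
  have hv' : x + s • (x - z) - w = e + s • b := by simp only [hb, he]; abel
  simp only [agdPotential, agdStep, hgx]
  rw [hv, hv']
  have n1 : ‖e + (s - 1) • b - (s / ℓ) • G‖ ^ 2 = ‖e‖ ^ 2 + (s - 1) ^ 2 * ‖b‖ ^ 2 +
      (s / ℓ) ^ 2 * ‖G‖ ^ 2 + 2 * (s - 1) * inner ℝ e b - 2 * (s / ℓ) * inner ℝ G e
      - 2 * (s / ℓ) * (s - 1) * inner ℝ G b := by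
    simp only [← real_inner_self_eq_norm_sq, inner_sub_left, inner_sub_right, inner_add_left,
      inner_add_right, inner_smul_left, inner_smul_right, RCLike.conj_to_real,
      real_inner_comm e b, real_inner_comm G e, real_inner_comm G b]
    rw [real_inner_comm b e, real_inner_comm e G, real_inner_comm b G]
    ring
  have n2 : ‖e + s • b‖ ^ 2 = ‖e‖ ^ 2 + s ^ 2 * ‖b‖ ^ 2 + 2 * s * inner ℝ e b := by
    rw [norm_add_sq_real, norm_smul, inner_smul_right, mul_pow, Real.norm_eq_abs, sq_abs]
    ring
  rw [n1, n2]
  have hα0 : 0 ≤ 1 / s := by positivity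
  have hα1 : 0 ≤ 1 - 1 / s := by
    rw [sub_nonneg, div_le_one hs0]; exact hs
  -- The lower bounds at z and at w are combined with weights 1 - 1/s and 1/s. Because ℓ = μs², all
  -- terms containing G then cancel, and only nonpositive multiples of ‖b‖² remain.
  have k2 := mul_le_mul_of_nonneg_left h2 hα1
  have k3 := mul_le_mul_of_nonneg_left h3 hα0
  have e1 : μ / 2 * ((s / ℓ) ^ 2 * ‖G‖ ^ 2) = ‖G‖ ^ 2 / (2 * ℓ) := by
    rw [hℓ]; field_simp
  have e2 : μ / 2 * (2 * (s / ℓ) * inner ℝ G e) = 1 / s * inner ℝ G e := by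
    rw [hℓ]; field_simp
  have e3 : μ / 2 * (2 * (s / ℓ) * (s - 1) * inner ℝ G b) = (1 - 1 / s) * inner ℝ G b := by
    rw [hℓ]; field_simp
  have key : μ / 2 * (‖e‖ ^ 2 + (s - 1) ^ 2 * ‖b‖ ^ 2 + 2 * (s - 1) * inner ℝ e b)
      - (1 - 1 / s) * (μ / 2 * (‖e‖ ^ 2 + s ^ 2 * ‖b‖ ^ 2 + 2 * s * inner ℝ e b))
      - (1 / s) * (μ / 2 * ‖e‖ ^ 2) = - (μ / 2) * ((s - 1) * ‖b‖ ^ 2) := by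
    field_simp
    ring
  have p1 : 0 ≤ (μ / 2) * ((s - 1) * ‖b‖ ^ 2) := by
    have : 0 ≤ s - 1 := by linarith
    positivity
  have p2 : 0 ≤ (1 - 1 / s) * (μ / 2 * ‖b‖ ^ 2) := by positivity
  linarith

/-- Linear convergence of accelerated gradient descent, in the distance to the minimizer. -/
theorem norm_agd_sub_le {h : Y → ℝ} {g : Y → Y} {μ ℓ κ : ℝ} (hμ : 0 < μ) (hκ : 1 ≤ κ)
    (hℓ : ℓ = μ * κ)
    (hg : ∀ x, HasGradientAt h (g x) x) (hl : ∀ x y, ‖g x - g y‖ ≤ ℓ * ‖x - y‖)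
    (hc : ∀ x y, h x + inner ℝ (g x) (y - x) + μ / 2 * ‖y - x‖ ^ 2 ≤ h y) {w : Y}
    (hw : g w = 0) (z₀ : Y) (K : ℕ) :
    ‖(agd h z₀ K (1 / ℓ) ((√κ - 1) / (√κ + 1))).z - w‖ ≤
      √(κ + 1) * Real.exp (-(K / (2 * √κ))) * ‖z₀ - w‖ := by
  have hs : 1 ≤ √κ := Real.one_le_sqrt.2 hκ
  have hs0 : 0 < √κ := by linarith
  have hℓs : ℓ = μ * √κ ^ 2 := by rw [Real.sq_sqrt (by linarith), hℓ]
  have hα1 : 0 ≤ 1 - 1 / √κ := by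
    rw [sub_nonneg, div_le_one hs0]; exact hs
  set A := fun k => agd h z₀ k (1 / ℓ) ((√κ - 1) / (√κ + 1)) with hA
  have hV : ∀ k, agdPotential h μ (√κ) w (A k) ≤
      (1 - 1 / √κ) ^ k * agdPotential h μ (√κ) w (A 0) := by
    intro k
    induction k with
    | zero => simp
    | succ k ih =>
      have h1 := agdPotential_step hμ hs hℓs hg hl hc w (A k)
      rw [hA]
      simp only [agd_succ]
      refine h1.trans ?_
      rw [pow_succ', mul_assoc]
      exact mul_le_mul_of_nonneg_left ih hα1
  -- The quotient of (ℓ + μ)/2 here by the μ/2 in `hK` is κ + 1, the source of √(κ + 1).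
  have h0 : agdPotential h μ (√κ) w (A 0) ≤ (ℓ + μ) / 2 * ‖z₀ - w‖ ^ 2 := by
    have h1 := le_quadratic_of_lipschitz_gradient hg hl w (z₀ - w)
    simp only [hw, inner_zero_left, add_sub_cancel] at h1
    simp only [hA, agd, agdPotential, Function.iterate_zero, id, sub_self, smul_zero, add_zero]
    linarith
  have hK : μ / 2 * ‖(A K).z - w‖ ^ 2 ≤ agdPotential h μ (√κ) w (A K) := by
    have h1 := hc w (A K).z
    simp only [hw, inner_zero_left, add_zero] at h1
    have : 0 ≤ μ / 2 * ‖(A K).zTilde + √κ • ((A K).zTilde - (A K).z) - w‖ ^ 2 := by positivity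
    simp only [agdPotential]
    linarith
  have hexp : (1 - 1 / √κ) ^ K ≤ Real.exp (-(K / (2 * √κ))) ^ 2 := by
    have h1 : 1 - 1 / √κ ≤ Real.exp (-(1 / √κ)) := by
      have := Real.add_one_le_exp (-(1 / √κ)); linarith
    refine (pow_le_pow_left₀ hα1 h1 K).trans (le_of_eq ?_)
    rw [← Real.exp_nat_mul, ← Real.exp_nat_mul]
    congr 1
    push_cast
    field_simp
  have hsq : ‖(A K).z - w‖ ^ 2 ≤
      (√(κ + 1) * Real.exp (-(K / (2 * √κ))) * ‖z₀ - w‖) ^ 2 := by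
    rw [mul_pow, mul_pow, Real.sq_sqrt (by linarith)]
    have h2 : μ / 2 * ‖(A K).z - w‖ ^ 2 ≤
        Real.exp (-(K / (2 * √κ))) ^ 2 * ((ℓ + μ) / 2 * ‖z₀ - w‖ ^ 2) := by
      refine (hK.trans (hV K)).trans ?_
      refine (mul_le_mul_of_nonneg_left h0 (by positivity)).trans ?_
      refine mul_le_mul_of_nonneg_right hexp ?_
      have : 0 < ℓ := by rw [hℓ]; positivity
      positivity
    have h3 : μ / 2 * ‖(A K).z - w‖ ^ 2 ≤
        μ / 2 * ((κ + 1) * Real.exp (-(K / (2 * √κ))) ^ 2 * ‖z₀ - w‖ ^ 2) := by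
      refine h2.trans (le_of_eq ?_)
      rw [hℓ]; ring
    exact le_of_mul_le_mul_left h3 (by positivity)
  exact le_of_sq_le_sq hsq (by positivity)

/-- The iteration number of the inner loop is large enough to reach the accuracy `e`. -/
theorem norm_agd_sub_le_of_ceil {h : Y → ℝ} {g : Y → Y} {μ ℓ κ e D : ℝ} (hμ : 0 < μ) (hκ : 1 ≤ κ)
    (hℓ : ℓ = μ * κ)
    (hg : ∀ x, HasGradientAt h (g x) x) (hl : ∀ x y, ‖g x - g y‖ ≤ ℓ * ‖x - y‖)
    (hc : ∀ x y, h x + inner ℝ (g x) (y - x) + μ / 2 * ‖y - x‖ ^ 2 ≤ h y) {w : Y}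
    (hw : g w = 0) (z₀ : Y) {K : ℕ} (he : 0 < e) (hD : ‖z₀ - w‖ ≤ D)
    (hK : K = ⌈2 * √κ * Real.log (√(κ + 1) / e * D)⌉₊) :
    ‖(agd h z₀ K (1 / ℓ) ((√κ - 1) / (√κ + 1))).z - w‖ ≤ e := by
  have hs0 : 0 < √κ := Real.sqrt_pos.2 (by linarith)
  have hq : 0 < √(κ + 1) := Real.sqrt_pos.2 (by linarith)
  refine (norm_agd_sub_le hμ hκ hℓ hg hl hc hw z₀ K).trans ?_
  have hD0 : 0 ≤ D := (norm_nonneg _).trans hD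
  rcases hD0.eq_or_lt with h0 | h0
  -- For D = 0 the start is already the minimizer, so the value of K, and with it the convention for
  -- log 0, does not matter.
  · have : ‖z₀ - w‖ = 0 := le_antisymm (by linarith) (norm_nonneg _)
    rw [this, mul_zero]; exact he.le
  have hlog : Real.log (√(κ + 1) / e * D) ≤ K / (2 * √κ) := by
    rw [le_div_iff₀ (by positivity), mul_comm, hK]
    exact Nat.le_ceil _
  have harg : 0 < √(κ + 1) / e * D := by positivity
  have hexp : Real.exp (-(K / (2 * √κ))) ≤ (√(κ + 1) / e * D)⁻¹ := by
    rw [← Real.exp_log harg, ← Real.exp_neg]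
    exact Real.exp_le_exp.2 (neg_le_neg hlog)
  calc √(κ + 1) * Real.exp (-(K / (2 * √κ))) * ‖z₀ - w‖
      ≤ √(κ + 1) * (√(κ + 1) / e * D)⁻¹ * D := by gcongr
    _ = e := by field_simp

end AGD

/-! ### Symmetry of Hessians and inverses of operators bounded below. -/

section Hessian

variable {E : Type} [NormedAddCommGroup E] [InnerProductSpace ℝ E]

/-- The Hessian is symmetric. -/
theorem inner_hessian_symm [CompleteSpace E] {h : E → ℝ} {g : E → E} {H : E →L[ℝ] E} {x : E}
    (hg : ∀ z, HasGradientAt h (g z) z) (hH : HasFDerivAt g H x) (v w : E) :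
    inner ℝ (H v) w = inner ℝ v (H w) := by
  have h1 : ∀ z, HasFDerivAt h (InnerProductSpace.toDualMap ℝ E (g z)) z :=
    fun z => (hg z).hasFDerivAt
  have h2 : HasFDerivAt (fun z => InnerProductSpace.toDualMap ℝ E (g z))
      ((innerSL ℝ).comp H) x := (innerSL ℝ (E := E)).hasFDerivAt.comp x hH
  have h3 := second_derivative_symmetric h1 h2 v w
  simp only [ContinuousLinearMap.comp_apply, innerSL_apply_apply] at h3
  rw [h3, real_inner_comm]

/-- The inverse of a bounded below operator on a finite-dimensional space. -/
theorem inverse_of_bddBelow [FiniteDimensional ℝ E] {D : E →L[ℝ] E} {μ : ℝ} (hμ : 0 < μ)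
    (hD : ∀ v, μ * ‖v‖ ≤ ‖D v‖) :
    (∀ v, D (D.inverse v) = v) ∧ (∀ v, D.inverse (D v) = v) ∧ ∀ v, ‖D.inverse v‖ ≤ ‖v‖ / μ := by
  have hinj : Function.Injective (D : E →ₗ[ℝ] E) := by
    rw [← LinearMap.ker_eq_bot, LinearMap.ker_eq_bot']
    intro v hv
    have h1 := hD v
    rw [show D v = 0 from hv, norm_zero] at h1
    exact norm_le_zero_iff.1 (by nlinarith [norm_nonneg v])
  -- In finite dimension injectivity gives an equivalence, so `inverse` is the true inverse and not
  -- its default value 0.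
  set e : E ≃L[ℝ] E := (LinearEquiv.ofInjectiveEndo _ hinj).toContinuousLinearEquiv with he
  have heD : (e : E →L[ℝ] E) = D := by ext v; rfl
  have hinv : D.inverse = (e.symm : E →L[ℝ] E) := by
    rw [← heD, ContinuousLinearMap.inverse_equiv]
  have h1 : ∀ v, D (D.inverse v) = v := fun v => by
    rw [hinv, ← heD]; simp
  refine ⟨h1, fun v => by rw [hinv, ← heD]; simp, fun v => ?_⟩
  rw [le_div_iff₀ hμ, mul_comm]
  simpa [h1] using hD (D.inverse v)

end Hessian

/-! ### Gradient and Hessian blocks of f, and the Schur complement. -/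

section Minimax

variable {X Y : Type} [NormedAddCommGroup X] [NormedAddCommGroup Y]

theorem pair_sub_pair (x x' : X) (y y' : Y) :
    pair x y - pair x' y' = (pair (x - x') (y - y') : Joint X Y) := rfl

theorem norm_pair_sq (x : X) (y : Y) : ‖(pair x y : Joint X Y)‖ ^ 2 = ‖x‖ ^ 2 + ‖y‖ ^ 2 :=
  WithLp.prod_norm_sq_eq_of_L2 _

variable [InnerProductSpace ℝ X] [InnerProductSpace ℝ Y]

/-- The inclusion `x ↦ (x, 0)`. -/
def inX (X Y : Type) [NormedAddCommGroup X] [InnerProductSpace ℝ X]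
    [NormedAddCommGroup Y] [InnerProductSpace ℝ Y] : X →L[ℝ] Joint X Y :=
  ((WithLp.prodContinuousLinearEquiv 2 ℝ X Y).symm : X × Y →L[ℝ] Joint X Y).comp
    (ContinuousLinearMap.inl ℝ X Y)

/-- The inclusion `y ↦ (0, y)`. -/
def inY (X Y : Type) [NormedAddCommGroup X] [InnerProductSpace ℝ X]
    [NormedAddCommGroup Y] [InnerProductSpace ℝ Y] : Y →L[ℝ] Joint X Y :=
  ((WithLp.prodContinuousLinearEquiv 2 ℝ X Y).symm : X × Y →L[ℝ] Joint X Y).comp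
    (ContinuousLinearMap.inr ℝ X Y)

theorem inX_apply (x : X) : inX X Y x = pair x 0 := rfl

theorem inY_apply (y : Y) : inY X Y y = pair 0 y := rfl

theorem norm_inX (x : X) : ‖inX X Y x‖ = ‖x‖ := WithLp.norm_toLp_fst 2 X Y x

theorem norm_inY (y : Y) : ‖inY X Y y‖ = ‖y‖ := WithLp.norm_toLp_snd 2 X Y y

theorem inner_inX (z : Joint X Y) (v : X) : inner ℝ z (inX X Y v) = inner ℝ z.fst v := by
  rw [WithLp.prod_inner_apply]
  simp [inX_apply, pair]

theorem inner_inY (z : Joint X Y) (v : Y) : inner ℝ z (inY X Y v) = inner ℝ z.snd v := by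
  rw [WithLp.prod_inner_apply]
  simp [inY_apply, pair]

theorem pair_eq (x : X) (y : Y) : (pair x y : Joint X Y) = inX X Y x + inY X Y y := by
  rw [inX_apply, inY_apply, pair, pair, pair, ← WithLp.toLp_add]
  simp

theorem norm_pair_sub_left (x x' : X) (y : Y) :
    ‖(pair x y - pair x' y : Joint X Y)‖ = ‖x - x'‖ := by
  rw [pair_sub_pair, sub_self]; exact norm_inX _

theorem norm_pair_sub_right (x : X) (y y' : Y) :
    ‖(pair x y - pair x y' : Joint X Y)‖ = ‖y - y'‖ := by
  rw [pair_sub_pair, sub_self]; exact norm_inY _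

theorem hasFDerivAt_pair_left (x : X) (y : Y) :
    HasFDerivAt (fun x' => (pair x' y : Joint X Y)) (inX X Y) x := by
  have : (fun x' => (pair x' y : Joint X Y)) = fun x' => inX X Y x' + inY X Y y := by
    funext x'; exact pair_eq x' y
  rw [this]
  exact (inX X Y).hasFDerivAt.add_const _

theorem hasFDerivAt_pair_right (x : X) (y : Y) :
    HasFDerivAt (fun y' => (pair x y' : Joint X Y)) (inY X Y) y := by
  have : (fun y' => (pair x y' : Joint X Y)) = fun y' => inX X Y x + inY X Y y' := by
    funext y'; exact pair_eq x y'
  rw [this]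
  exact (inY X Y).hasFDerivAt.const_add _

/-- Pointwise bounds for the blocks of an operator on the joint space. -/
theorem norm_blocks_le {T : Joint X Y →L[ℝ] Joint X Y} {c : ℝ} (hT : ‖T‖ ≤ c) :
    (∀ v, ‖(T (inX X Y v)).fst‖ ≤ c * ‖v‖) ∧ (∀ v, ‖(T (inY X Y v)).fst‖ ≤ c * ‖v‖) ∧
      (∀ v, ‖(T (inX X Y v)).snd‖ ≤ c * ‖v‖) := by
  refine ⟨fun v => ?_, fun v => ?_, fun v => ?_⟩
  · refine (WithLp.norm_fst_le X _).trans ((T.le_of_opNorm_le hT _).trans ?_)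
    rw [norm_inX]
  · refine (WithLp.norm_fst_le X _).trans ((T.le_of_opNorm_le hT _).trans ?_)
    rw [norm_inY]
  · refine (WithLp.norm_snd_le X _).trans ((T.le_of_opNorm_le hT _).trans ?_)
    rw [norm_inX]

variable [CompleteSpace X] [CompleteSpace Y]

variable {f : Joint X Y → ℝ} {μ ℓ ρ : ℝ}

theorem Assumptions.hasGradientAt (hf : Assumptions f μ ℓ ρ) (z : Joint X Y) :
    HasGradientAt f (gradient f z) z := (hf.differentiable z).hasGradientAt

theorem Assumptions.hasFDerivAt_gradient (hf : Assumptions f μ ℓ ρ) (z : Joint X Y) :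
    HasFDerivAt (gradient f) (hessian f z) z := (hf.twice_differentiable z).hasFDerivAt

theorem Assumptions.hasGradientAt_left (hf : Assumptions f μ ℓ ρ) (x : X) (y : Y) :
    HasGradientAt (fun x' => f (pair x' y)) (gradient f (pair x y)).fst x := by
  rw [hasGradientAt_iff_hasFDerivAt]
  refine ((hf.hasGradientAt (pair x y)).hasFDerivAt.comp x
    (hasFDerivAt_pair_left x y)).congr_fderiv ?_
  ext v
  exact inner_inX (gradient f (pair x y)) v

theorem Assumptions.hasGradientAt_right (hf : Assumptions f μ ℓ ρ) (x : X) (y : Y) :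
    HasGradientAt (fun y' => f (pair x y')) (gradient f (pair x y)).snd y := by
  rw [hasGradientAt_iff_hasFDerivAt]
  refine ((hf.hasGradientAt (pair x y)).hasFDerivAt.comp y
    (hasFDerivAt_pair_right x y)).congr_fderiv ?_
  ext v
  exact inner_inY (gradient f (pair x y)) v

theorem Assumptions.gradX_eq (hf : Assumptions f μ ℓ ρ) (x : X) (y : Y) :
    gradX f x y = (gradient f (pair x y)).fst := (hf.hasGradientAt_left x y).gradient

theorem Assumptions.gradY_eq (hf : Assumptions f μ ℓ ρ) (x : X) (y : Y) :
    gradY f x y = (gradient f (pair x y)).snd := (hf.hasGradientAt_right x y).gradient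

theorem Assumptions.hessXX_eq (hf : Assumptions f μ ℓ ρ) (x : X) (y : Y) :
    hessXX f x y = (WithLp.fstL 2 ℝ X Y).comp ((hessian f (pair x y)).comp (inX X Y)) := by
  unfold hessXX
  simp only [hf.gradX_eq]
  exact ((WithLp.fstL 2 ℝ X Y).hasFDerivAt.comp x
    ((hf.hasFDerivAt_gradient _).comp x (hasFDerivAt_pair_left x y))).fderiv

theorem Assumptions.hessXY_eq (hf : Assumptions f μ ℓ ρ) (x : X) (y : Y) :
    hessXY f x y = (WithLp.fstL 2 ℝ X Y).comp ((hessian f (pair x y)).comp (inY X Y)) := by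
  unfold hessXY
  simp only [hf.gradX_eq]
  exact ((WithLp.fstL 2 ℝ X Y).hasFDerivAt.comp y
    ((hf.hasFDerivAt_gradient _).comp y (hasFDerivAt_pair_right x y))).fderiv

theorem Assumptions.hessYX_eq (hf : Assumptions f μ ℓ ρ) (x : X) (y : Y) :
    hessYX f x y = (WithLp.sndL 2 ℝ X Y).comp ((hessian f (pair x y)).comp (inX X Y)) := by
  unfold hessYX
  simp only [hf.gradY_eq]
  exact ((WithLp.sndL 2 ℝ X Y).hasFDerivAt.comp x
    ((hf.hasFDerivAt_gradient _).comp x (hasFDerivAt_pair_left x y))).fderiv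

theorem Assumptions.hessYY_eq (hf : Assumptions f μ ℓ ρ) (x : X) (y : Y) :
    hessYY f x y = (WithLp.sndL 2 ℝ X Y).comp ((hessian f (pair x y)).comp (inY X Y)) := by
  unfold hessYY
  simp only [hf.gradY_eq]
  exact ((WithLp.sndL 2 ℝ X Y).hasFDerivAt.comp y
    ((hf.hasFDerivAt_gradient _).comp y (hasFDerivAt_pair_right x y))).fderiv

theorem Assumptions.norm_gradX_sub_le (hf : Assumptions f μ ℓ ρ) (x x' : X) (y y' : Y) :
    ‖gradX f x y - gradX f x' y'‖ ≤ ℓ * ‖(pair x y - pair x' y' : Joint X Y)‖ := by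
  rw [hf.gradX_eq, hf.gradX_eq, ← WithLp.sub_fst]
  exact (WithLp.norm_fst_le X _).trans (hf.gradient_lipschitz _ _)

theorem Assumptions.norm_gradY_sub_le (hf : Assumptions f μ ℓ ρ) (x x' : X) (y y' : Y) :
    ‖gradY f x y - gradY f x' y'‖ ≤ ℓ * ‖(pair x y - pair x' y' : Joint X Y)‖ := by
  rw [hf.gradY_eq, hf.gradY_eq, ← WithLp.sub_snd]
  exact (WithLp.norm_snd_le X _).trans (hf.gradient_lipschitz _ _)

/-- Strong concavity in `y`, first-order form. -/
theorem Assumptions.le_quadratic (hf : Assumptions f μ ℓ ρ) (x : X) (y y' : Y) :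
    f (pair x y') ≤ f (pair x y) + inner ℝ (gradY f x y) (y' - y) - μ / 2 * ‖y' - y‖ ^ 2 := by
  rw [hf.gradY_eq]
  exact StrongConcave.le_quadratic (hf.strongly_concave x) (hf.hasGradientAt_right x y) y'

/-- Strong monotonicity of `-∇_y f`. -/
theorem Assumptions.inner_gradY_sub_le (hf : Assumptions f μ ℓ ρ) (x : X) (y y' : Y) :
    inner ℝ (gradY f x y' - gradY f x y) (y' - y) ≤ -(μ * ‖y' - y‖ ^ 2) := by
  have h1 := hf.le_quadratic x y y'
  have h2 := hf.le_quadratic x y' y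
  rw [norm_sub_rev y y', ← neg_sub y' y, inner_neg_right] at h2
  rw [inner_sub_left]
  linarith

/-- Cauchy–Schwarz applied to strong monotonicity. This single lower bound yields κ ≥ 1, the
Lipschitz continuity of y* and the invertibility of the yy block. -/
theorem Assumptions.mul_norm_sub_le (hf : Assumptions f μ ℓ ρ) (x : X) (y y' : Y) :
    μ * ‖y' - y‖ ≤ ‖gradY f x y' - gradY f x y‖ := by
  rcases (norm_nonneg (y' - y)).eq_or_lt with h | h
  · rw [← h]; simp
  · have h1 := hf.inner_gradY_sub_le x y y'
    have h2 := neg_le_of_abs_le (abs_real_inner_le_norm (gradY f x y' - gradY f x y) (y' - y))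
    refine le_of_mul_le_mul_right ?_ h
    nlinarith

/-- A nonzero displacement in y, available because q ≥ 1, changes ∇_y f by at least μ and at most ℓ
times its length. This is κ ≥ 1. -/
theorem Assumptions.le_lipschitz [Nontrivial Y] (hf : Assumptions f μ ℓ ρ) : μ ≤ ℓ := by
  obtain ⟨v, hv⟩ := exists_ne (0 : Y)
  have h1 := hf.mul_norm_sub_le 0 0 v
  have h2 := hf.norm_gradY_sub_le 0 0 v 0
  rw [norm_pair_sub_right] at h2
  exact le_of_mul_le_mul_right (h1.trans h2) (by simpa using hv)

/-- The limit of `mul_norm_sub_le` along difference quotients; it bounds the inverse of the yy block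
by 1/μ. -/
theorem Assumptions.mul_norm_le_hessYY (hf : Assumptions f μ ℓ ρ) (x : X) (y v : Y) :
    μ * ‖v‖ ≤ ‖hessYY f x y v‖ := by
  have hd : HasFDerivAt (fun y' => gradY f x y') (hessYY f x y) y := by
    rw [hf.hessYY_eq]
    simp only [hf.gradY_eq]
    exact ((WithLp.sndL 2 ℝ X Y).hasFDerivAt.comp y
      ((hf.hasFDerivAt_gradient _).comp y (hasFDerivAt_pair_right x y)))
  have h1 : HasDerivAt (fun t : ℝ => y + t • v) v 0 := by
    simpa using ((hasDerivAt_id (0 : ℝ)).smul_const v).const_add y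
  have hd' : HasFDerivAt (fun y' => gradY f x y') (hessYY f x y) (y + (0 : ℝ) • v) := by
    simpa using hd
  have h2 : HasDerivAt (fun t : ℝ => gradY f x (y + t • v)) (hessYY f x y v) 0 :=
    hd'.comp_hasDerivAt (0 : ℝ) h1
  have h3 := (hasDerivAt_iff_tendsto_slope.1 h2).norm
  refine ge_of_tendsto h3 ?_
  filter_upwards [self_mem_nhdsWithin] with t ht
  have ht' : 0 < |t| := abs_pos.2 ht
  have h4 := hf.mul_norm_sub_le x y (y + t • v)
  rw [add_sub_cancel_left, norm_smul, Real.norm_eq_abs] at h4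
  rw [slope_def_module, norm_smul, sub_zero, norm_inv, Real.norm_eq_abs, zero_smul, add_zero,
    inv_mul_eq_div, le_div_iff₀ ht']
  linarith

theorem Assumptions.norm_hessian_le (hf : Assumptions f μ ℓ ρ) (hℓ : 0 ≤ ℓ) (z : Joint X Y) :
    ‖hessian f z‖ ≤ ℓ :=
  (hf.hasFDerivAt_gradient z).le_of_lip' hℓ (Eventually.of_forall fun w =>
    hf.gradient_lipschitz w z)

theorem Assumptions.schur_apply (hf : Assumptions f μ ℓ ρ) (x : X) (y : Y) (v : X) :
    schurHessian f x y v = (hessian f (pair x y) (inX X Y v)).fst -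
      (hessian f (pair x y) (inY X Y ((hessYY f x y).inverse
        (hessian f (pair x y) (inX X Y v)).snd))).fst := by
  simp only [schurHessian, hf.hessXX_eq, hf.hessXY_eq, hf.hessYX_eq]
  rfl

theorem Assumptions.hessYY_apply (hf : Assumptions f μ ℓ ρ) (x : X) (y v : Y) :
    hessYY f x y v = (hessian f (pair x y) (inY X Y v)).snd := by
  rw [hf.hessYY_eq]; rfl

variable [FiniteDimensional ℝ Y]

/-- The Schur complement of the Hessian is bounded. -/
theorem Assumptions.norm_schurHessian_le (hf : Assumptions f μ ℓ ρ) (hμ : 0 < μ) (hℓ : μ ≤ ℓ)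
    (x : X) (y : Y) : ‖schurHessian f x y‖ ≤ 2 * (ℓ / μ) * ℓ := by
  have hℓ0 : 0 ≤ ℓ := hμ.le.trans hℓ
  obtain ⟨b1, b2, b3⟩ := norm_blocks_le (hf.norm_hessian_le hℓ0 (pair x y))
  obtain ⟨-, -, hi⟩ := inverse_of_bddBelow hμ (hf.mul_norm_le_hessYY x y)
  have hκ : 1 ≤ ℓ / μ := by rwa [le_div_iff₀ hμ, one_mul]
  refine ContinuousLinearMap.opNorm_le_bound _ (by positivity) fun v => ?_
  rw [hf.schur_apply]
  calc _ ≤ ℓ * ‖v‖ + ℓ * (ℓ * ‖v‖ / μ) := by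
        refine (norm_sub_le _ _).trans (add_le_add (b1 v) ((b2 _).trans ?_))
        gcongr
        exact (hi _).trans (by gcongr; exact b3 v)
    _ = (1 + ℓ / μ) * ℓ * ‖v‖ := by field_simp
    _ ≤ _ := by gcongr; linarith

/-- The Schur complement of the Hessian is jointly Lipschitz. -/
theorem Assumptions.norm_schurHessian_sub_le (hf : Assumptions f μ ℓ ρ) (hμ : 0 < μ)
    (hℓ : μ ≤ ℓ) (hρ : 0 ≤ ρ) (x x' : X) (y y' : Y) :
    ‖schurHessian f x y - schurHessian f x' y'‖ ≤
      4 * (ℓ / μ) ^ 2 * ρ * ‖(pair x y - pair x' y' : Joint X Y)‖ := by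
  have hℓ0 : 0 ≤ ℓ := hμ.le.trans hℓ
  have hκ : 1 ≤ ℓ / μ := by rwa [le_div_iff₀ hμ, one_mul]
  set n := ‖(pair x y - pair x' y' : Joint X Y)‖ with hn
  have hn0 : 0 ≤ n := norm_nonneg _
  set H := hessian f (pair x y) with hH
  set H' := hessian f (pair x' y') with hH'
  obtain ⟨b1, b2, b3⟩ := norm_blocks_le (hf.norm_hessian_le hℓ0 (pair x y))
  obtain ⟨c1, c2, c3⟩ := norm_blocks_le (hf.norm_hessian_le hℓ0 (pair x' y'))
  obtain ⟨d1, d2, d3⟩ := norm_blocks_le (hf.hessian_lipschitz (pair x y) (pair x' y'))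
  obtain ⟨-, il, hi⟩ := inverse_of_bddBelow hμ (hf.mul_norm_le_hessYY x y)
  obtain ⟨ir', -, hi'⟩ := inverse_of_bddBelow hμ (hf.mul_norm_le_hessYY x' y')
  have d4 : ∀ v, ‖hessYY f x' y' v - hessYY f x y v‖ ≤ ρ * n * ‖v‖ := by
    intro v
    rw [hf.hessYY_apply, hf.hessYY_apply, ← WithLp.sub_snd, ← sub_apply,
      ← norm_neg, ← WithLp.neg_snd, ← neg_apply, neg_sub]
    refine (WithLp.norm_snd_le X _).trans ((ContinuousLinearMap.le_of_opNorm_le _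
      (hf.hessian_lipschitz (pair x y) (pair x' y')) _).trans ?_)
    rw [norm_inY]
  refine ContinuousLinearMap.opNorm_le_bound _ (by positivity) fun v => ?_
  set w := (H (inX X Y v)).snd with hw
  set w' := (H' (inX X Y v)).snd with hw'
  set p := (hessYY f x y).inverse w with hp
  set p' := (hessYY f x' y').inverse w' with hp'
  have hww : ‖w - w'‖ ≤ ρ * n * ‖v‖ := by
    have := d3 v
    rwa [sub_apply, WithLp.sub_snd] at this
  have hpn' : ‖p'‖ ≤ ℓ / μ * ‖v‖ := by
    refine (hi' _).trans ?_
    rw [div_mul_eq_mul_div]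
    gcongr
    exact c3 v
  have hpp : ‖p - p'‖ ≤ (ρ * n * ‖v‖ + ρ * n * (ℓ / μ * ‖v‖)) / μ := by
    -- The resolvent identity: with D and D' the two yy blocks, D⁻¹w - D'⁻¹w' = D⁻¹((w - w') + (D' -
    -- D)p').
    have e1 : p - p' = (hessYY f x y).inverse
        ((w - w') + (hessYY f x' y' p' - hessYY f x y p')) := by
      rw [hp', ir', ← hp', map_add, map_sub, map_sub, il]
      abel
    rw [e1]
    refine (hi _).trans ?_
    gcongr
    refine (norm_add_le _ _).trans (add_le_add hww ((d4 _).trans ?_))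
    gcongr
  have e2 : (schurHessian f x y - schurHessian f x' y') v =
      (((H - H') (inX X Y v)).fst - ((H - H') (inY X Y p')).fst) - (H (inY X Y (p - p'))).fst := by
    rw [sub_apply, hf.schur_apply, hf.schur_apply]
    simp only [sub_apply, map_sub, WithLp.sub_fst]
    simp only [← hH, ← hH', ← hw, ← hw', ← hp, ← hp']
    abel
  rw [e2]
  have k0 : 0 ≤ ρ * n := by positivity
  calc _ ≤ ρ * n * ‖v‖ + ρ * n * (ℓ / μ * ‖v‖) +
        ℓ * ((ρ * n * ‖v‖ + ρ * n * (ℓ / μ * ‖v‖)) / μ) := by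
        refine (norm_sub_le _ _).trans (add_le_add ((norm_sub_le _ _).trans
          (add_le_add (d1 v) ((d2 _).trans ?_))) ((b2 _).trans ?_))
        · gcongr
        · gcongr
    _ = (1 + ℓ / μ) ^ 2 * (ρ * n * ‖v‖) := by field_simp
    _ ≤ (2 * (ℓ / μ)) ^ 2 * (ρ * n * ‖v‖) := by gcongr; linarith
    _ = _ := by ring

/-- The Schur complement of the Hessian is symmetric. -/
theorem Assumptions.inner_schurHessian_symm (hf : Assumptions f μ ℓ ρ) (hμ : 0 < μ)
    (x : X) (y : Y) (v w : X) :
    inner ℝ (schurHessian f x y v) w = inner ℝ v (schurHessian f x y w) := by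
  have hs := inner_hessian_symm hf.hasGradientAt (hf.hasFDerivAt_gradient (pair x y))
  obtain ⟨ir, -, -⟩ := inverse_of_bddBelow hμ (hf.mul_norm_le_hessYY x y)
  set H := hessian f (pair x y) with hH
  have sXX : ∀ v w : X, inner ℝ (H (inX X Y v)).fst w = inner ℝ v (H (inX X Y w)).fst := by
    intro v w
    rw [← inner_inX, hs, real_inner_comm, inner_inX, real_inner_comm]
  have sXY : ∀ (v : Y) (w : X), inner ℝ (H (inY X Y v)).fst w = inner ℝ v (H (inX X Y w)).snd := by
    intro v w
    rw [← inner_inX, hs, real_inner_comm, inner_inY, real_inner_comm]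
  have sYY : ∀ v w : Y, inner ℝ (hessYY f x y v) w = inner ℝ v (hessYY f x y w) := by
    intro v w
    rw [hf.hessYY_apply, hf.hessYY_apply, ← inner_inY, hs, real_inner_comm, inner_inY,
      real_inner_comm]
  rw [hf.schur_apply, hf.schur_apply, inner_sub_left, inner_sub_right, ← hH, sXX, sXY]
  congr 1
  rw [real_inner_comm _ v, sXY]
  conv_lhs => rw [← ir (H (inX X Y w)).snd]
  rw [← sYY, ir, real_inner_comm]

end Minimax

/-! ### The maximizer y*, the derivatives of φ, and the effect of inexact maximization. -/

section Primal

variable {X Y : Type} [NormedAddCommGroup X] [NormedAddCommGroup Y]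
  [InnerProductSpace ℝ X] [InnerProductSpace ℝ Y] [CompleteSpace X] [CompleteSpace Y]
  [FiniteDimensional ℝ Y] {f : Joint X Y → ℝ} {μ ℓ ρ : ℝ}

/-- Strong concavity bounds f(x, ·) above by a quadratic tending to -∞, so a continuous function on
a finite-dimensional space attains its maximum. -/
theorem Assumptions.exists_max (hf : Assumptions f μ ℓ ρ) (hμ : 0 < μ) (x : X) :
    ∃ y : Y, ∀ y', f (pair x y') ≤ f (pair x y) := by
  have hcont : Continuous fun y : Y => f (pair x y) := by
    rw [continuous_iff_continuousAt]
    exact fun y => (hf.hasGradientAt_right x y).hasFDerivAt.continuousAt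
  refine hcont.exists_forall_ge ?_
  have h1 : Tendsto (fun y : Y => ‖y‖ * (‖gradY f x 0‖ - μ / 2 * ‖y‖) + f (pair x 0))
      (cocompact Y) atBot := by
    have hn : Tendsto (fun y : Y => ‖y‖) (cocompact Y) atTop := tendsto_norm_cocompact_atTop
    refine tendsto_atBot_add_const_right _ _ (hn.atTop_mul_atBot₀ ?_)
    have := (tendsto_neg_atTop_atBot.comp (hn.const_mul_atTop (half_pos hμ)))
    refine (tendsto_atBot_add_const_left _ ‖gradY f x 0‖ this).congr fun y => ?_
    simp only [Function.comp_apply]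
    ring
  refine tendsto_atBot_mono (fun y => ?_) h1
  have h2 := hf.le_quadratic x 0 y
  have h3 := real_inner_le_norm (gradY f x 0) (y - 0)
  rw [sub_zero] at h2 h3
  nlinarith

theorem Assumptions.le_yStar (hf : Assumptions f μ ℓ ρ) (hμ : 0 < μ) (x : X) (y : Y) :
    f (pair x y) ≤ f (pair x (yStar f x)) :=
  Classical.epsilon_spec (hf.exists_max hμ x) y

theorem Assumptions.primal_eq (hf : Assumptions f μ ℓ ρ) (hμ : 0 < μ) (x : X) :
    primal f x = f (pair x (yStar f x)) :=
  le_antisymm (ciSup_le (hf.le_yStar hμ x))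
    (le_ciSup (f := fun y => f (pair x y))
      ⟨_, forall_mem_range.2 (hf.le_yStar hμ x)⟩ (yStar f x))

theorem Assumptions.gradY_yStar (hf : Assumptions f μ ℓ ρ) (hμ : 0 < μ) (x : X) :
    gradY f x (yStar f x) = 0 := by
  have h1 : IsLocalMax (fun y => f (pair x y)) (yStar f x) :=
    Eventually.of_forall (hf.le_yStar hμ x)
  have h2 := h1.hasFDerivAt_eq_zero (hf.hasGradientAt_right x (yStar f x)).hasFDerivAt
  rw [hf.gradY_eq]
  simpa using h2

/-- The maximizer is a `κ`-Lipschitz function of `x`. -/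
theorem Assumptions.norm_yStar_sub_le (hf : Assumptions f μ ℓ ρ) (hμ : 0 < μ) (x x' : X) :
    ‖yStar f x - yStar f x'‖ ≤ ℓ / μ * ‖x - x'‖ := by
  -- The vector ∇_y f(x, y*(x')) is compared with the two zero gradients at (x, y*(x)) and (x',
  -- y*(x')): it is at least μ‖y*(x) - y*(x')‖ and at most ℓ‖x - x'‖.
  have h1 := hf.mul_norm_sub_le x (yStar f x') (yStar f x)
  have h2 := hf.norm_gradY_sub_le x' x (yStar f x') (yStar f x')
  rw [hf.gradY_yStar hμ] at h1 h2
  rw [norm_pair_sub_left, norm_sub_rev x'] at h2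
  rw [div_mul_eq_mul_div, le_div_iff₀ hμ, mul_comm]
  exact h1.trans h2

/-- The maximizer is differentiable, by implicit differentiation. -/
theorem Assumptions.hasFDerivAt_yStar (hf : Assumptions f μ ℓ ρ) (hμ : 0 < μ) (x : X) :
    HasFDerivAt (yStar f) (-((hessYY f x (yStar f x)).inverse.comp (hessYX f x (yStar f x)))) x := by
  obtain ⟨-, il, -⟩ := inverse_of_bddBelow hμ (hf.mul_norm_le_hessYY x (yStar f x))
  set H := hessian f (pair x (yStar f x)) with hH
  set D := hessYY f x (yStar f x) with hD
  have hcont : Tendsto (yStar f) (𝓝 x) (𝓝 (yStar f x)) := by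
    rw [tendsto_iff_norm_sub_tendsto_zero]
    refine squeeze_zero (fun _ => norm_nonneg _) (fun x' => hf.norm_yStar_sub_le hμ x' x) ?_
    have : Tendsto (fun x' => ‖x' - x‖) (𝓝 x) (𝓝 0) := tendsto_iff_norm_sub_tendsto_zero.1 tendsto_id
    simpa using this.const_mul (ℓ / μ)
  have hp : Tendsto (fun x' => (pair x' (yStar f x') : Joint X Y)) (𝓝 x)
      (𝓝 (pair x (yStar f x))) := by
    have : ∀ x', (pair x' (yStar f x') : Joint X Y) = inX X Y x' + inY X Y (yStar f x') :=
      fun x' => pair_eq _ _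
    simp only [this]
    exact ((inX X Y).continuous.tendsto x).add (((inY X Y).continuous.tendsto _).comp hcont)
  have hO : (fun x' => (pair x' (yStar f x') : Joint X Y) - pair x (yStar f x)) =O[𝓝 x]
      fun x' => x' - x := by
    refine Asymptotics.IsBigO.of_bound (1 + ℓ / μ) (Eventually.of_forall fun x' => ?_)
    rw [pair_sub_pair, pair_eq]
    refine (norm_add_le _ _).trans ?_
    rw [norm_inX, norm_inY, add_mul, one_mul]
    gcongr
    exact hf.norm_yStar_sub_le hμ x' x
  -- The Lipschitz bound on y* makes the remainder of ∇f along (x', y*(x')) an o(x' - x). Its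
  -- y-component involves two vanishing gradients, so applying D⁻¹ to it leaves exactly the
  -- remainder of y*, with opposite sign.
  have h1 := (((hasFDerivAt_iff_isLittleO.1 (hf.hasFDerivAt_gradient (pair x (yStar f x)))).comp_tendsto
    hp).trans_isBigO hO)
  have h2 := ((D.inverse.comp (WithLp.sndL 2 ℝ X Y)).isBigO_comp (fun x' =>
    gradient f (pair x' (yStar f x')) - gradient f (pair x (yStar f x)) -
      H (pair x' (yStar f x') - pair x (yStar f x))) (𝓝 x)).trans_isLittleO h1
  rw [hasFDerivAt_iff_isLittleO]
  refine h2.neg_left.congr_left fun x' => ?_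
  have g1 : ∀ x', (gradient f (pair x' (yStar f x'))).snd = 0 := fun x' => by
    rw [← hf.gradY_eq, hf.gradY_yStar hμ]
  have g2 : (H (pair x' (yStar f x') - pair x (yStar f x))).snd =
      hessYX f x (yStar f x) (x' - x) + D (yStar f x' - yStar f x) := by
    rw [pair_sub_pair, pair_eq, map_add, WithLp.add_snd, hf.hessYX_eq, hD, hf.hessYY_apply]
    rfl
  rw [ContinuousLinearMap.comp_apply, WithLp.sndL_apply, WithLp.sub_snd, WithLp.sub_snd, g1, g1, g2,
    neg_apply, ContinuousLinearMap.comp_apply, sub_zero, zero_sub, map_neg, map_add, il]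
  abel

theorem Assumptions.hasFDerivAt_pair_yStar (hf : Assumptions f μ ℓ ρ) (hμ : 0 < μ) (x : X) :
    HasFDerivAt (fun x' => (pair x' (yStar f x') : Joint X Y)) (inX X Y + (inY X Y).comp
      (-((hessYY f x (yStar f x)).inverse.comp (hessYX f x (yStar f x))))) x := by
  simp only [pair_eq]
  exact (inX X Y).hasFDerivAt.add ((inY X Y).hasFDerivAt.comp x (hf.hasFDerivAt_yStar hμ x))

/-- Danskin's theorem. -/
theorem Assumptions.hasGradientAt_primal (hf : Assumptions f μ ℓ ρ) (hμ : 0 < μ) (x : X) :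
    HasGradientAt (primal f) (gradX f x (yStar f x)) x := by
  have hp := hf.hasFDerivAt_pair_yStar hμ x
  have h1 := (hf.hasGradientAt (pair x (yStar f x))).hasFDerivAt.comp x hp
  rw [hasGradientAt_iff_hasFDerivAt]
  have h2 : primal f = fun x' => f (pair x' (yStar f x')) := funext (hf.primal_eq hμ)
  rw [h2]
  refine h1.congr_fderiv ?_
  ext v
  -- The derivative of y* enters only through this vanishing component.
  have g1 : (gradient f (pair x (yStar f x))).snd = 0 := by rw [← hf.gradY_eq, hf.gradY_yStar hμ]
  have h3 : ∀ z : Joint X Y, InnerProductSpace.toDual ℝ (Joint X Y) (gradient f (pair x (yStar f x))) z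
      = inner ℝ (gradient f (pair x (yStar f x))) z := fun z => rfl
  rw [ContinuousLinearMap.comp_apply, h3, add_apply, inner_add_right,
    ContinuousLinearMap.comp_apply, inner_inX, inner_inY, g1, inner_zero_left, add_zero,
    ← hf.gradX_eq]
  rfl

theorem Assumptions.gradient_primal (hf : Assumptions f μ ℓ ρ) (hμ : 0 < μ) :
    gradient (primal f) = fun x => gradX f x (yStar f x) :=
  funext fun x => (hf.hasGradientAt_primal hμ x).gradient

/-- The chain rule for ∇ₓf(x, y*(x)) with the implicit derivative of y*. The matrix H̃ of the method
is thus ∇²φ with y* replaced by its approximation. -/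
theorem Assumptions.hasFDerivAt_gradient_primal (hf : Assumptions f μ ℓ ρ) (hμ : 0 < μ) (x : X) :
    HasFDerivAt (gradient (primal f)) (schurHessian f x (yStar f x)) x := by
  have hp := hf.hasFDerivAt_pair_yStar hμ x
  have h1 := (WithLp.fstL 2 ℝ X Y).hasFDerivAt.comp x
    ((hf.hasFDerivAt_gradient (pair x (yStar f x))).comp x hp)
  have h2 : gradient (primal f) = (WithLp.fstL 2 ℝ X Y) ∘
      (gradient f ∘ fun x' => pair x' (yStar f x')) := by
    rw [hf.gradient_primal hμ]
    funext x
    exact hf.gradX_eq _ _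
  rw [h2]
  refine h1.congr_fderiv ?_
  ext1 v
  rw [hf.schur_apply]
  simp only [ContinuousLinearMap.comp_apply, add_apply, neg_apply, map_add, map_neg,
    WithLp.fstL_apply, sub_eq_add_neg, hf.hessYX_eq,
    WithLp.sndL_apply]

theorem Assumptions.hessian_primal (hf : Assumptions f μ ℓ ρ) (hμ : 0 < μ) (x : X) :
    hessian (primal f) x = schurHessian f x (yStar f x) :=
  (hf.hasFDerivAt_gradient_primal hμ x).fderiv

/-- The Hessian of the primal function is Lipschitz. -/
theorem Assumptions.norm_hessian_primal_sub_le (hf : Assumptions f μ ℓ ρ) (hμ : 0 < μ)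
    (hℓ : μ ≤ ℓ) (hρ : 0 ≤ ρ) (x x' : X) :
    ‖hessian (primal f) x - hessian (primal f) x'‖ ≤ 4 * √2 * (ℓ / μ) ^ 3 * ρ * ‖x - x'‖ := by
  have hκ : 1 ≤ ℓ / μ := by rwa [le_div_iff₀ hμ, one_mul]
  rw [hf.hessian_primal hμ, hf.hessian_primal hμ]
  refine (hf.norm_schurHessian_sub_le hμ hℓ hρ _ _ _ _).trans ?_
  -- The factor √2 comes from 1 + κ² ≤ 2κ².
  have h1 : ‖(pair x (yStar f x) - pair x' (yStar f x') : Joint X Y)‖ ≤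
      √2 * (ℓ / μ) * ‖x - x'‖ := by
    refine le_of_sq_le_sq ?_ (by positivity)
    rw [pair_sub_pair, norm_pair_sq, mul_pow, mul_pow, Real.sq_sqrt (by norm_num)]
    have h2 := pow_le_pow_left₀ (norm_nonneg _) (hf.norm_yStar_sub_le hμ x x') 2
    have h3 : 1 ≤ (ℓ / μ) ^ 2 := one_le_pow₀ hκ
    nlinarith [sq_nonneg ‖x - x'‖]
  calc _ ≤ 4 * (ℓ / μ) ^ 2 * ρ * (√2 * (ℓ / μ) * ‖x - x'‖) := by gcongr
    _ = _ := by ring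

/-- Gradient error at an approximate maximizer. -/
theorem Assumptions.norm_gradX_sub_gradient_primal_le (hf : Assumptions f μ ℓ ρ) (hμ : 0 < μ)
    (x : X) (y : Y) : ‖gradX f x y - gradient (primal f) x‖ ≤ ℓ * ‖y - yStar f x‖ := by
  rw [hf.gradient_primal hμ]
  refine (hf.norm_gradX_sub_le _ _ _ _).trans ?_
  rw [norm_pair_sub_right]

/-- Hessian error at an approximate maximizer: the geometric mean of the bounds that come from
Lipschitz continuity and from boundedness. -/
theorem Assumptions.sq_norm_schurHessian_sub_hessian_primal_le (hf : Assumptions f μ ℓ ρ)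
    (hμ : 0 < μ) (hℓ : μ ≤ ℓ) (hρ : 0 ≤ ρ) (x : X) (y : Y) :
    ‖schurHessian f x y - hessian (primal f) x‖ ^ 2 ≤
      16 * (ℓ / μ) ^ 3 * ρ * (ℓ * ‖y - yStar f x‖) := by
  have h0 : 0 < ℓ := hμ.trans_le hℓ
  rw [hf.hessian_primal hμ]
  have h1 := hf.norm_schurHessian_sub_le hμ hℓ hρ x x y (yStar f x)
  rw [norm_pair_sub_right] at h1
  have h2 := (norm_sub_le (schurHessian f x y) (schurHessian f x (yStar f x))).trans
    (add_le_add (hf.norm_schurHessian_le hμ hℓ x y) (hf.norm_schurHessian_le hμ hℓ x (yStar f x)))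
  calc _ = ‖schurHessian f x y - schurHessian f x (yStar f x)‖ *
        ‖schurHessian f x y - schurHessian f x (yStar f x)‖ := sq _
    _ ≤ (4 * (ℓ / μ) ^ 2 * ρ * ‖y - yStar f x‖) * (2 * (ℓ / μ) * ℓ + 2 * (ℓ / μ) * ℓ) := by
        gcongr
    _ = _ := by ring

/-- Accelerated gradient descent with the prescribed number of steps reaches the accuracy `e`. -/
theorem Assumptions.norm_innerLoop_sub_le [Nontrivial Y] (hf : Assumptions f μ ℓ ρ) (hμ : 0 < μ)
    {x : X} {y : Y} {K : ℕ} {e D : ℝ} (he : 0 < e) (hD : ‖y - yStar f x‖ ≤ D)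
    (hK : K = ⌈2 * √(ℓ / μ) * Real.log (√(ℓ / μ + 1) / e * D)⌉₊) :
    ‖(agd (fun y => -f (pair x y)) y K (1 / ℓ) ((√(ℓ / μ) - 1) / (√(ℓ / μ) + 1))).z - yStar f x‖
      ≤ e := by
  have hℓ := hf.le_lipschitz
  have hκ : 1 ≤ ℓ / μ := by rwa [le_div_iff₀ hμ, one_mul]
  refine norm_agd_sub_le_of_ceil (g := fun y => -gradY f x y) hμ hκ (by field_simp)
    (fun y => ?_) (fun y y' => ?_) (fun y y' => ?_) ?_ y he hD hK
  · rw [hasGradientAt_iff_hasFDerivAt, map_neg, hf.gradY_eq]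
    exact (hf.hasGradientAt_right x y).hasFDerivAt.neg
  · rw [neg_sub_neg, norm_sub_rev, ← norm_pair_sub_right x y y']
    exact hf.norm_gradY_sub_le x x y y'
  · rw [inner_neg_left]
    linarith [hf.le_quadratic x y y']
  · simp [hf.gradY_yStar hμ]

end Primal

/-! ### Existence and optimality conditions of minimizers of the cubic model. -/

section Cubic

variable {X : Type} [NormedAddCommGroup X] [InnerProductSpace ℝ X]

/-- The cubic model has a global minimizer. -/
theorem exists_cubicModel_min [FiniteDimensional ℝ X] (g : X) (H : X →L[ℝ] X) {M : ℝ}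
    (hM : 0 < M) : ∃ s, ∀ s', cubicModel g H M s ≤ cubicModel g H M s' := by
  have hcont : Continuous (cubicModel g H M) := by
    unfold cubicModel
    fun_prop
  refine hcont.exists_forall_le ?_
  have hn : Tendsto (fun s : X => ‖s‖) (cocompact X) atTop := tendsto_norm_cocompact_atTop
  have h1 : Tendsto (fun s : X => ‖s‖ * (‖s‖ * (M / 6 * ‖s‖ - ‖H‖ / 2) - ‖g‖))
      (cocompact X) atTop := by
    refine hn.atTop_mul_atTop₀ (tendsto_atTop_add_const_right _ _ (hn.atTop_mul_atTop₀ ?_))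
    exact tendsto_atTop_add_const_right _ _ (hn.const_mul_atTop (by positivity))
  refine tendsto_atTop_mono (fun s => ?_) h1
  have h2 := neg_le_of_abs_le (abs_real_inner_le_norm g s)
  have h3 := neg_le_of_abs_le (abs_real_inner_le_norm s (H s))
  have h4 := mul_le_mul_of_nonneg_left (H.le_opNorm s) (norm_nonneg s)
  unfold cubicModel
  nlinarith

/-- First-order condition at a global minimizer of the cubic model. -/
theorem cubicModel_stationary {g : X} {H : X →L[ℝ] X} {M : ℝ} {s : X}
    (hH : ∀ v w, inner ℝ (H v) w = inner ℝ v (H w))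
    (hs : ∀ s', cubicModel g H M s ≤ cubicModel g H M s') :
    g + H s + (M / 2 * ‖s‖) • s = 0 := by
  have hmin : IsLocalMin (cubicModel g H M) s := Eventually.of_forall hs
  have d1 : HasFDerivAt (fun s : X => inner ℝ g s) (innerSL ℝ g) s := (innerSL ℝ g).hasFDerivAt
  have d2 : HasFDerivAt (fun s : X => inner ℝ s (H s)) _ s :=
    (hasFDerivAt_id s).inner ℝ H.hasFDerivAt
  have d3 : HasFDerivAt (fun s : X => ‖s‖ ^ 3) ((3 * ‖s‖) • innerSL ℝ s) s := by
    have h := hasFDerivAt_norm_rpow s (p := 3) (by norm_num)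
    have e1 : (3 : ℝ) - 2 = 1 := by norm_num
    rw [e1, Real.rpow_one] at h
    refine h.congr_of_eventuallyEq (Eventually.of_forall fun z => ?_)
    exact_mod_cast (Real.rpow_natCast ‖z‖ 3).symm
  have h0 := hmin.hasFDerivAt_eq_zero ((d1.add (d2.const_mul (1 / 2))).add (d3.const_mul (M / 6)))
  refine ext_inner_right ℝ fun v => ?_
  have h1 := congrArg (fun T : X →L[ℝ] ℝ => T v) h0
  simp only [add_apply, smul_apply, innerSL_apply_apply, ContinuousLinearMap.comp_apply,
    ContinuousLinearMap.prod_apply, fderivInnerCLM_apply, ContinuousLinearMap.id_apply,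
    zero_apply, smul_eq_mul, id] at h1
  have h2 : inner ℝ v (H s) = inner ℝ s (H v) := by rw [← hH, real_inner_comm]
  rw [h2] at h1
  rw [inner_zero_left, inner_add_left, inner_add_left, inner_smul_left, hH, RCLike.conj_to_real]
  linarith

/-- Second-order condition at a global minimizer of the cubic model. -/
theorem cubicModel_second_order {g : X} {H : X →L[ℝ] X} {M : ℝ} {s : X}
    (hH : ∀ v w, inner ℝ (H v) w = inner ℝ v (H w))
    (hs : ∀ s', cubicModel g H M s ≤ cubicModel g H M s') (v : X) :
    0 ≤ inner ℝ v (H v) + M / 2 * ‖s‖ * ‖v‖ ^ 2 := by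
  have hst := cubicModel_stationary hH hs
  -- For s = 0 also g = 0, and the model at tv, divided by t², is examined as t → 0⁺.
  rcases eq_or_ne s 0 with rfl | hs0
  · have hg : g = 0 := by simpa using hst
    have h1 : Tendsto (fun t : ℝ => inner ℝ v (H v) / 2 + M / 6 * t * ‖v‖ ^ 3) (𝓝[>] 0)
        (𝓝 (inner ℝ v (H v) / 2 + M / 6 * 0 * ‖v‖ ^ 3)) := by
      refine Tendsto.mono_left (Continuous.tendsto ?_ 0) nhdsWithin_le_nhds
      fun_prop
    have h2 : 0 ≤ inner ℝ v (H v) / 2 + M / 6 * 0 * ‖v‖ ^ 3 := by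
      refine ge_of_tendsto h1 ?_
      filter_upwards [self_mem_nhdsWithin] with t ht
      have ht' : (0 : ℝ) < t := ht
      have h3 := hs (t • v)
      simp only [cubicModel, hg, inner_zero_left, norm_zero, map_zero, map_smul, inner_smul_left,
        inner_smul_right, norm_smul, Real.norm_of_nonneg ht'.le, RCLike.conj_to_real] at h3
      have h4 : 0 ≤ t ^ 2 * (inner ℝ v (H v) / 2 + M / 6 * t * ‖v‖ ^ 3) := by linarith
      exact nonneg_of_mul_nonneg_right h4 (by positivity)
    simp only [norm_zero]
    linarith
  · have key : ∀ w : X, inner ℝ w s ≠ 0 → 0 ≤ inner ℝ w (H w) + M / 2 * ‖s‖ * ‖w‖ ^ 2 := by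
      intro w hw
      have hw0 : w ≠ 0 := by rintro rfl; simp at hw
      have hwn : 0 < ‖w‖ ^ 2 := by positivity
      -- With this τ, s + τw is the second point of the line on the sphere of radius ‖s‖. The cubic
      -- term is unchanged, and stationarity reduces the difference of model values to τ²/2 times
      -- the claimed expression.
      set τ : ℝ := -2 * inner ℝ w s / ‖w‖ ^ 2 with hτ
      have hτ0 : τ ≠ 0 := by rw [hτ]; positivity
      have hτw : τ * ‖w‖ ^ 2 = -2 * inner ℝ w s := by rw [hτ]; field_simp
      have hn : ‖s + τ • w‖ ^ 2 = ‖s‖ ^ 2 := by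
        rw [norm_add_sq_real, norm_smul, inner_smul_right, mul_pow, Real.norm_eq_abs, sq_abs,
          real_inner_comm w s]
        linear_combination τ * hτw
      have hn' : ‖s + τ • w‖ = ‖s‖ := by
        rwa [sq_eq_sq₀ (norm_nonneg _) (norm_nonneg _)] at hn
      have h1 := hs (s + τ • w)
      have hgw : inner ℝ g w = -inner ℝ s (H w) - M / 2 * ‖s‖ * inner ℝ w s := by
        have := congrArg (fun z => inner ℝ z w) hst
        simp only [inner_add_left, inner_smul_left, inner_zero_left, RCLike.conj_to_real, hH] at this
        rw [real_inner_comm] at this ⊢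
        rw [real_inner_comm s w]
        linarith
      have hws : inner ℝ w (H s) = inner ℝ s (H w) := by rw [← hH, real_inner_comm]
      simp only [cubicModel, hn', inner_add_right, inner_add_left, map_add, map_smul,
        inner_smul_left, inner_smul_right, RCLike.conj_to_real, hgw, hws] at h1
      have h2 : 0 ≤ τ ^ 2 * (inner ℝ w (H w) + M / 2 * ‖s‖ * ‖w‖ ^ 2) := by
        clear_value τ
        linear_combination 2 * h1 - M / 2 * ‖s‖ * τ * hτw
      exact nonneg_of_mul_nonneg_right h2 (by positivity)
    -- A direction orthogonal to s is tangent to the sphere, and is reached as the limit of v + ts.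
    by_cases hv : inner ℝ v s = 0
    · have h1 : Tendsto (fun t : ℝ => inner ℝ (v + t • s) (H (v + t • s)) +
          M / 2 * ‖s‖ * ‖v + t • s‖ ^ 2) (𝓝[≠] 0)
          (𝓝 (inner ℝ (v + (0 : ℝ) • s) (H (v + (0 : ℝ) • s)) +
            M / 2 * ‖s‖ * ‖v + (0 : ℝ) • s‖ ^ 2)) := by
        refine Tendsto.mono_left (Continuous.tendsto ?_ 0) nhdsWithin_le_nhds
        fun_prop
      have h2 := ge_of_tendsto (b := 0) h1 (by
        filter_upwards [self_mem_nhdsWithin] with t ht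
        refine key _ ?_
        have ht' : t ≠ 0 := ht
        rw [inner_add_left, hv, zero_add, inner_smul_left, real_inner_self_eq_norm_sq]
        simp [ht', hs0])
      simpa using h2
    · exact key v hv

/-- The quadratic part of the model decreases by at least `M ‖s‖³ / 4`. -/
theorem cubicModel_decrease {g : X} {H : X →L[ℝ] X} {M : ℝ} {s : X}
    (hH : ∀ v w, inner ℝ (H v) w = inner ℝ v (H w))
    (hs : ∀ s', cubicModel g H M s ≤ cubicModel g H M s') :
    inner ℝ g s + 1 / 2 * inner ℝ s (H s) ≤ -(M / 4 * ‖s‖ ^ 3) := by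
  have h1 := congrArg (fun z => inner ℝ z s) (cubicModel_stationary hH hs)
  simp only [inner_add_left, inner_smul_left, inner_zero_left, RCLike.conj_to_real, hH,
    real_inner_self_eq_norm_sq] at h1
  have h2 := cubicModel_second_order hH hs s
  linarith

end Cubic

/-! ### Taylor estimates for a function with Lipschitz Hessian. -/

section Taylor

variable {X : Type} [NormedAddCommGroup X] [InnerProductSpace ℝ X]
  {φ : X → ℝ} {G : X → X} {H : X → X →L[ℝ] X} {L : ℝ}

/-- The mean value inequality on a ball gives the constant L instead of the sharp L/2, and likewise
L instead of L/6 in `le_cubic_taylor`. The later margins afford this. -/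
theorem norm_gradient_taylor_le (hL : 0 ≤ L) (hH : ∀ x, HasFDerivAt G (H x) x)
    (hLip : ∀ x x', ‖H x - H x'‖ ≤ L * ‖x - x'‖) (x s : X) :
    ‖G (x + s) - G x - H x s‖ ≤ L * ‖s‖ ^ 2 := by
  have h := (convex_closedBall x ‖s‖).norm_image_sub_le_of_norm_hasFDerivWithin_le'
    (f := G) (f' := H) (φ := H x) (C := L * ‖s‖) (x := x) (y := x + s)
    (fun z _ => (hH z).hasFDerivWithinAt)
    (fun z hz => (hLip z x).trans (by
      gcongr; simpa [dist_eq_norm] using hz)) (by simp) (by simp)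
  rw [add_sub_cancel_left] at h
  refine h.trans (le_of_eq (by ring))

theorem le_cubic_taylor [CompleteSpace X] (hL : 0 ≤ L) (hG : ∀ x, HasGradientAt φ (G x) x)
    (hH : ∀ x, HasFDerivAt G (H x) x)
    (hLip : ∀ x x', ‖H x - H x'‖ ≤ L * ‖x - x'‖) (x s : X) :
    φ (x + s) ≤ φ x + inner ℝ (G x) s + 1 / 2 * inner ℝ s (H x s) + L * ‖s‖ ^ 3 := by
  set ψ : ℝ → ℝ := fun t => φ (x + t • s) - t * inner ℝ (G x) s -
    1 / 2 * inner ℝ s (H x s) * t ^ 2 - L * ‖s‖ ^ 3 * t with hψ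
  have hd : ∀ t, HasDerivAt ψ (inner ℝ (G (x + t • s)) s - inner ℝ (G x) s
      - inner ℝ s (H x s) * t - L * ‖s‖ ^ 3) t := by
    intro t
    exact ((((hasDerivAt_line hG x s t).sub ((hasDerivAt_id t).mul_const (inner ℝ (G x) s))).sub
      ((hasDerivAt_pow 2 t).const_mul (1 / 2 * inner ℝ s (H x s)))).sub
      ((hasDerivAt_id t).const_mul (L * ‖s‖ ^ 3))).congr_deriv (by simp; ring)
  have hanti : AntitoneOn ψ (Icc 0 1) := by
    refine antitoneOn_of_hasDerivWithinAt_nonpos (convex_Icc 0 1)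
      (fun t _ => (hd t).continuousAt.continuousWithinAt)
      (fun t _ => (hd t).hasDerivWithinAt) ?_
    intro t ht
    rw [interior_Icc] at ht
    have h1 : inner ℝ (G (x + t • s) - G x - H x (t • s)) s ≤ L * ‖s‖ ^ 3 := by
      refine (real_inner_le_norm _ _).trans ?_
      calc _ ≤ L * ‖t • s‖ ^ 2 * ‖s‖ := by
            gcongr; exact norm_gradient_taylor_le hL hH hLip x (t • s)
        _ ≤ L * (1 * ‖s‖) ^ 2 * ‖s‖ := by
            rw [norm_smul, Real.norm_of_nonneg ht.1.le]
            have := ht.1.le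
            have := ht.2.le
            gcongr
        _ = _ := by ring
    rw [inner_sub_left, inner_sub_left, map_smul, inner_smul_left, RCLike.conj_to_real,
      real_inner_comm s (H x s)] at h1
    linarith
  have := hanti (left_mem_Icc.2 zero_le_one) (right_mem_Icc.2 zero_le_one) zero_le_one
  simp [hψ] at this
  linarith

end Taylor

/-! ### One iteration: stationarity if the test passes, descent if it fails. -/

section Step

variable {X : Type} [NormedAddCommGroup X] [InnerProductSpace ℝ X]
  {φ : X → ℝ} {G : X → X} {H : X → X →L[ℝ] X} {L M u : ℝ} {g x xt s : X} {Ht : X →L[ℝ] X}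

/-- Here r is the step length and b the distance to the snapshot. The square of the test dominates M
times the gradient terms free of u; the factor 287/288 leaves room for the errors, since (287/288)²
+ 1/576 + 2/1000 < 1, and 287/288 + 1/1000 < 1 for the curvature. -/
theorem stop_bound {P r b : ℝ} (hL : 0 ≤ L) (hM : 0 < M) (hr : 0 ≤ r) (hb : 0 ≤ b) (hu : 0 ≤ u)
    (hP : P = (M + 2 * L) / √2) (hD : P * r + L * b ≤ 287 / 288 * (M * u)) :
    L * r ^ 2 + M * u ^ 2 / 576 + (M * u / 1000 + L * b) * r + M / 2 * r ^ 2 ≤ M * u ^ 2 ∧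
      M / 2 * r + M * u / 1000 + L * b + L * r ≤ M * u := by
  have hP2 : P ^ 2 = (M + 2 * L) ^ 2 / 2 := by
    rw [hP, div_pow, Real.sq_sqrt (by norm_num)]
  have hP0 : 0 ≤ P := by rw [hP]; positivity
  have hP1 : (M + 2 * L) / 2 ≤ P := by
    refine le_of_sq_le_sq ?_ hP0
    rw [hP2]; nlinarith [sq_nonneg (M + 2 * L)]
  have hLb : 0 ≤ L * b := mul_nonneg hL hb
  have hPr := mul_le_mul_of_nonneg_right hP1 hr
  have hMu : 0 ≤ M * u := by positivity
  have hLr : 0 ≤ L * r := mul_nonneg hL hr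
  constructor
  · have hD2 : (P * r + L * b) ^ 2 ≤ (287 / 288 * (M * u)) ^ 2 :=
      pow_le_pow_left₀ (by positivity) hD 2
    have h1 : M * (L * r ^ 2 + L * b * r + M / 2 * r ^ 2) ≤ (P * r + L * b) ^ 2 := by
      have e1 : (P * r + L * b) ^ 2 = (M + 2 * L) ^ 2 / 2 * r ^ 2 + 2 * (P * r) * (L * b) +
          (L * b) ^ 2 := by rw [← hP2]; ring
      rw [e1]
      have e2 : M * r * (L * b) ≤ 2 * (P * r) * (L * b) :=
        mul_le_mul_of_nonneg_right (by linarith) hLb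
      nlinarith [sq_nonneg (L * b), sq_nonneg (L * r), mul_nonneg hM.le (mul_nonneg hL (sq_nonneg r))]
    have h2 : L * r ^ 2 + L * b * r + M / 2 * r ^ 2 ≤ (287 / 288) ^ 2 * (M * u ^ 2) := by
      refine le_of_mul_le_mul_left ((h1.trans hD2).trans (le_of_eq ?_)) hM
      ring
    have h3 : r ≤ 2 * u := by
      refine le_of_mul_le_mul_left (?_ : M * r ≤ M * (2 * u)) hM
      nlinarith
    have h4 : M * u * r ≤ M * u * (2 * u) := by gcongr
    nlinarith [mul_nonneg hMu hu]
  · linarith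

/-- If the stopping test is passed, the new point is second-order stationary. -/
theorem stationary_of_stop (hL : 0 ≤ L) (hM : 0 < M) (hu : 0 ≤ u)
    (hH : ∀ x, HasFDerivAt G (H x) x) (hLip : ∀ x x', ‖H x - H x'‖ ≤ L * ‖x - x'‖)
    (hsym : ∀ v w, inner ℝ (Ht v) w = inner ℝ v (Ht w))
    (hg : ‖g - G x‖ ≤ M * u ^ 2 / 576) (hHt : ‖Ht - H xt‖ ≤ M * u / 1000)
    (hs : ∀ s', cubicModel g Ht M s ≤ cubicModel g Ht M s')
    (hD : (M + 2 * L) / √2 * ‖s‖ + L * ‖xt - x‖ ≤ 287 / 288 * (M * u)) :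
    ‖G (x + s)‖ ≤ M * u ^ 2 ∧ ∀ v, -(M * u) * ‖v‖ ^ 2 ≤ inner ℝ v (H (x + s) v) := by
  obtain ⟨k1, k2⟩ := stop_bound hL hM (norm_nonneg s) (norm_nonneg (xt - x)) hu rfl hD
  constructor
  · have h1 := norm_gradient_taylor_le hL hH hLip x s
    have h2 := cubicModel_stationary hsym hs
    -- The terms are the Taylor remainder, the gradient error, the lag of the snapshot, the snapshot
    -- error and the cubic term; stationarity of the model removes the rest.
    have e1 : G (x + s) = (G (x + s) - G x - H x s) - (g - G x) +
        (-((H xt - H x) s) + -((Ht - H xt) s)) + -((M / 2 * ‖s‖) • s) := by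
      rw [← neg_eq_of_add_eq_zero_right h2]
      simp only [sub_apply]
      abel
    have h3 : ‖(H xt - H x) s‖ ≤ L * ‖xt - x‖ * ‖s‖ :=
      (H xt - H x).le_of_opNorm_le (hLip xt x) s
    have h4 : ‖(Ht - H xt) s‖ ≤ M * u / 1000 * ‖s‖ := (Ht - H xt).le_of_opNorm_le hHt s
    have h5 : ‖(M / 2 * ‖s‖) • s‖ = M / 2 * ‖s‖ ^ 2 := by
      rw [norm_smul, Real.norm_of_nonneg (by positivity)]; ring
    rw [e1]
    refine (norm_add_le _ _).trans ?_
    have h6 := norm_add_le ((G (x + s) - G x - H x s) - (g - G x))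
        (-((H xt - H x) s) + -((Ht - H xt) s))
    have h7 := norm_sub_le (G (x + s) - G x - H x s) (g - G x)
    have h8 := norm_add_le (-((H xt - H x) s)) (-((Ht - H xt) s))
    rw [norm_neg, norm_neg] at h8
    rw [norm_neg, h5]
    linarith
  · intro v
    have h1 := cubicModel_second_order hsym hs v
    have h2 := neg_le_of_abs_le (abs_real_inner_le_norm v ((H (x + s) - H xt) v))
    have h3 := neg_le_of_abs_le (abs_real_inner_le_norm v ((H xt - Ht) v))
    have h4 : ‖(H (x + s) - H xt) v‖ ≤ L * (‖xt - x‖ + ‖s‖) * ‖v‖ := by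
      refine ContinuousLinearMap.le_of_opNorm_le _ ((hLip _ _).trans ?_) v
      gcongr
      rw [show x + s - xt = -(xt - x) + s by abel]
      refine (norm_add_le _ _).trans ?_
      rw [norm_neg]
    have h5 : ‖(H xt - Ht) v‖ ≤ M * u / 1000 * ‖v‖ :=
      ContinuousLinearMap.le_of_opNorm_le _ (by rwa [norm_sub_rev]) v
    have h6 := mul_le_mul_of_nonneg_left h4 (norm_nonneg v)
    have h7 := mul_le_mul_of_nonneg_left h5 (norm_nonneg v)
    have h8 := mul_le_mul_of_nonneg_right k2 (sq_nonneg ‖v‖)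
    simp only [sub_apply, inner_sub_right] at h2 h3 h6 h7
    nlinarith

/-- E = Lb/M is the scaled lag of the snapshot. The mixed terms are split by comparing E with r/10
or r, which costs little of the available r³/4 and puts the rest on E³. -/
theorem descent_bound {r E : ℝ} (hr : 0 ≤ r) (hE : 0 ≤ E) (hu : 0 ≤ u) (h : u ≤ r + 2 * E) :
    -(1 / 4 * r ^ 3) + u ^ 2 / 576 * r + 1 / 2 * ((u / 1000 + E) * r ^ 2) + 1 / 10000 * r ^ 3 ≤
      -(9 / 50 * r ^ 3) + 51 * E ^ 3 ∧ u ^ 3 ≤ 4 * r ^ 3 + 32 * E ^ 3 := by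
  have h1 : E * r ^ 2 ≤ r ^ 3 / 10 + 100 * E ^ 3 := by
    rcases le_total E (r / 10) with h | h
    · have := mul_le_mul_of_nonneg_right h (sq_nonneg r)
      have : 0 ≤ E ^ 3 := by positivity
      linarith
    · have h' : r ≤ 10 * E := by linarith
      have := mul_le_mul_of_nonneg_left (pow_le_pow_left₀ hr h' 2) hE
      have : 0 ≤ r ^ 3 := by positivity
      nlinarith
  have h2 : E ^ 2 * r ≤ r ^ 3 + E ^ 3 := by
    rcases le_total E r with h | h
    · have := mul_le_mul_of_nonneg_right (pow_le_pow_left₀ hE h 2) hr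
      have : 0 ≤ E ^ 3 := by positivity
      linarith
    · have := mul_le_mul_of_nonneg_left h (sq_nonneg E)
      have : 0 ≤ r ^ 3 := by positivity
      nlinarith
  have h3 : u ^ 2 * r ≤ (r + 2 * E) ^ 2 * r := by gcongr
  have h4 : u * r ^ 2 ≤ (r + 2 * E) * r ^ 2 := by gcongr
  have h5 : 0 ≤ r ^ 3 := by positivity
  have h6 : 0 ≤ E ^ 3 := by positivity
  constructor
  · nlinarith
  · have h7 : u ^ 3 ≤ (r + 2 * E) ^ 3 := by gcongr
    have h8 : (r + 2 * E) ^ 3 ≤ 4 * r ^ 3 + 32 * E ^ 3 := by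
      nlinarith [mul_nonneg (add_nonneg hr (mul_nonneg zero_le_two hE)) (sq_nonneg (r - 2 * E))]
    exact h7.trans h8

/-- If the stopping test is failed, the step decreases the function, up to the effect of the old
snapshot. -/
theorem descent_of_not_stop [CompleteSpace X] (hL : 0 ≤ L) (hM : 0 < M) (hLM : 10000 * L ≤ M)
    (hu : 0 ≤ u) (hG : ∀ x, HasGradientAt φ (G x) x)
    (hH : ∀ x, HasFDerivAt G (H x) x) (hLip : ∀ x x', ‖H x - H x'‖ ≤ L * ‖x - x'‖)
    (hsym : ∀ v w, inner ℝ (Ht v) w = inner ℝ v (Ht w))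
    (hg : ‖g - G x‖ ≤ M * u ^ 2 / 576) (hHt : ‖Ht - H xt‖ ≤ M * u / 1000)
    (hs : ∀ s', cubicModel g Ht M s ≤ cubicModel g Ht M s')
    (hD : 287 / 288 * (M * u) ≤ (M + 2 * L) / √2 * ‖s‖ + L * ‖xt - x‖) :
    φ (x + s) - φ x ≤ M * (-(9 / 50 * ‖s‖ ^ 3) + 51 * (L / M * ‖xt - x‖) ^ 3) ∧
      u ^ 3 ≤ 4 * ‖s‖ ^ 3 + 32 * (L / M * ‖xt - x‖) ^ 3 := by
  set r := ‖s‖ with hr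
  set E := L / M * ‖xt - x‖ with hE
  have hr0 : 0 ≤ r := norm_nonneg s
  have hE0 : 0 ≤ E := by positivity
  have hEb : L * ‖xt - x‖ = M * E := by rw [hE]; field_simp
  have hsq : 7 / 5 ≤ √2 := Real.le_sqrt_of_sq_le (by norm_num)
  -- After division by M, the failed test reads (287/288)u ≤ (18/25)r + E, as L ≤ M/10000 and √2 ≥
  -- 7/5.
  have huE : u ≤ r + 2 * E := by
    have h1 : (M + 2 * L) / √2 ≤ 18 / 25 * M := by
      rw [div_le_iff₀ (by positivity)]
      nlinarith
    have h2 := mul_le_mul_of_nonneg_right h1 hr0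
    rw [hEb] at hD
    have h3 : M * (287 / 288 * u) ≤ M * (18 / 25 * r + E) := by linarith
    have h4 := le_of_mul_le_mul_left h3 hM
    linarith
  obtain ⟨k1, k2⟩ := descent_bound hr0 hE0 hu huE
  refine ⟨?_, k2⟩
  have h1 := le_cubic_taylor hL hG hH hLip x s
  have h2 := cubicModel_decrease hsym hs
  have h3 := neg_le_of_abs_le (abs_real_inner_le_norm (g - G x) s)
  have h4 := real_inner_le_norm s ((H x - H xt) s)
  have h5 := neg_le_of_abs_le (abs_real_inner_le_norm s ((Ht - H xt) s))
  have h6 : ‖(H x - H xt) s‖ ≤ M * E * r := by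
    rw [← hEb]
    exact (H x - H xt).le_of_opNorm_le (by rw [norm_sub_rev xt]; exact hLip _ _) s
  have h7 : ‖(Ht - H xt) s‖ ≤ M * u / 1000 * r := (Ht - H xt).le_of_opNorm_le hHt s
  have h8 := mul_le_mul_of_nonneg_right hg hr0
  have h9 := mul_le_mul_of_nonneg_left h6 hr0
  have h10 := mul_le_mul_of_nonneg_left h7 hr0
  simp only [sub_apply, inner_sub_right, inner_sub_left] at h3 h4 h5 h9 h10
  have h11 := mul_le_mul_of_nonneg_left k1 hM.le
  have h12 := mul_le_mul_of_nonneg_right hLM (pow_nonneg hr0 3)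
  refine le_trans ?_ h11
  simp only [← hr] at *
  nlinarith

end Step

/-! ### Summing the lag over periods between snapshots. -/

section Window

/-- Sums of cubes over lazy windows of length at most `m`. -/
theorem sum_cube_window_le {r b : ℕ → ℝ} {m n : ℕ} (hm : 0 < m) (hr : ∀ t, 0 ≤ r t)
    (hb0 : ∀ t, 0 ≤ b t) (hb : ∀ t < n, b t ≤ ∑ j ∈ Finset.Ico (t - t % m) t, r j) :
    ∑ t ∈ Finset.range n, b t ^ 3 ≤ (m : ℝ) ^ 3 * ∑ t ∈ Finset.range n, r t ^ 3 := by
  have h1 : ∀ t ∈ Finset.range n, b t ^ 3 ≤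
      ∑ j ∈ Finset.range n, if t ∈ Finset.Ioo j (j + m) then (m : ℝ) ^ 2 * r j ^ 3 else 0 := by
    intro t ht
    rw [Finset.mem_range] at ht
    -- Power mean inequality over at most m terms. The third factor m comes from counting: step j
    -- occurs only for t with j < t < j + m.
    have h2 : b t ^ 3 ≤ (m : ℝ) ^ 2 * ∑ j ∈ Finset.Ico (t - t % m) t, r j ^ 3 := by
      refine (pow_le_pow_left₀ (hb0 t) (hb t ht) 3).trans ?_
      refine (pow_sum_le_card_mul_sum_pow (fun j _ => hr j) 2).trans ?_
      rw [Nat.card_Ico]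
      have : t - (t - t % m) ≤ m := by
        have := Nat.mod_lt t hm
        omega
      have h3 : ((t - (t - t % m) : ℕ) : ℝ) ≤ m := by exact_mod_cast this
      have h4 : 0 ≤ ∑ j ∈ Finset.Ico (t - t % m) t, r j ^ 3 :=
        Finset.sum_nonneg fun j _ => pow_nonneg (hr j) 3
      gcongr
    refine h2.trans ?_
    rw [Finset.mul_sum, ← Finset.sum_filter]
    refine Finset.sum_le_sum_of_subset_of_nonneg (fun j hj => ?_) fun j _ _ => ?_
    · have := Nat.mod_lt t hm
      simp only [Finset.mem_Ico, Finset.mem_filter, Finset.mem_range, Finset.mem_Ioo] at hj ⊢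
      omega
    · have := hr j
      positivity
  refine (Finset.sum_le_sum h1).trans ?_
  rw [Finset.sum_comm, Finset.mul_sum]
  refine Finset.sum_le_sum fun j _ => ?_
  rw [← Finset.sum_filter, Finset.sum_const, nsmul_eq_mul]
  have h5 : ((Finset.range n).filter fun t => t ∈ Finset.Ioo j (j + m)).card ≤ m := by
    refine (Finset.card_le_card (t := Finset.Ioo j (j + m)) fun t ht => ?_).trans ?_
    · exact (Finset.mem_filter.1 ht).2
    · rw [Nat.card_Ioo]; omega
  have h6 : (((Finset.range n).filter fun t => t ∈ Finset.Ioo j (j + m)).card : ℝ) ≤ m := by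
    exact_mod_cast h5
  have := hr j
  calc _ ≤ (m : ℝ) * ((m : ℝ) ^ 2 * r j ^ 3) := by gcongr
    _ = _ := by ring

end Window

/-! ### Accuracy, stationarity and total descent along a run. -/

section Run

variable {X Y : Type} [NormedAddCommGroup X] [NormedAddCommGroup Y]
  [InnerProductSpace ℝ X] [InnerProductSpace ℝ Y] [CompleteSpace X] [CompleteSpace Y]

/-- A run of the method with admissible parameters. -/
structure Setting (f : Joint X Y → ℝ) (μ ℓ ρ : ℝ) (I : Input X) (σ : ℕ → State X Y) (n : ℕ) :
    Prop where
  assumptions : Assumptions f μ ℓ ρ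
  mu_pos : 0 < μ
  rho_pos : 0 < ρ
  kappa_eq : I.κ₁ = ℓ / μ
  ell_eq : I.ℓ₁ = ℓ
  rhobar_eq : I.ρbar = 4 * √2 * (ℓ / μ) ^ 3 * ρ
  eps_pos : 0 < I.ε
  m_pos : 0 < I.m
  M_ge : 10000 * (I.m * I.ρbar) ≤ I.M
  run : IsRun f I σ n
  schedule : IsSchedule f I.κ₁ (innerAccuracy ℓ ρ I.M I.ε) I.K σ n

variable {f : Joint X Y → ℝ} {μ ℓ ρ : ℝ} {I : Input X} {σ : ℕ → State X Y} {n : ℕ}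

/-- The snapshot in use in iteration `t` was taken in the last iteration divisible by `m`. -/
theorem Setting.snapshot (h : Setting f μ ℓ ρ I σ n) {t : ℕ} (ht : t < n) :
    (σ (t + 1)).xTilde = (σ (t - t % I.m)).x ∧ (σ (t + 1)).HTilde =
      schurHessian f (σ (t - t % I.m)).x (σ (t - t % I.m + 1)).y := by
  induction t with
  | zero =>
    have hi := h.run.iteration 0 ht
    rw [hi.xTilde_eq, hi.HTilde_eq]
    simp
  | succ t ih =>
    have hi := h.run.iteration (t + 1) ht
    rw [hi.xTilde_eq, hi.HTilde_eq]
    by_cases hd : (t + 1) % I.m = 0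
    · simp [hd]
    · rw [if_neg hd, if_neg hd]
      -- If m does not divide t + 1, then t and t + 1 have the same last multiple of m.
      have e : t + 1 - (t + 1) % I.m = t - t % I.m := by
        have h1 := Nat.succ_div_of_not_dvd (a := t) (b := I.m)
          (fun hdvd => hd (Nat.mod_eq_zero_of_dvd hdvd))
        have h2 := Nat.div_add_mod t I.m
        have h3 := Nat.div_add_mod (t + 1) I.m
        rw [h1] at h3
        omega
      rw [e]
      exact ih (by omega)

theorem Setting.snapshot_symm [FiniteDimensional ℝ Y] (h : Setting f μ ℓ ρ I σ n) {t : ℕ} (ht : t < n) (v w : X) :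
    inner ℝ ((σ (t + 1)).HTilde v) w = inner ℝ v ((σ (t + 1)).HTilde w) := by
  rw [(h.snapshot ht).2]
  exact h.assumptions.inner_schurHessian_symm h.mu_pos _ _ v w

variable [Nontrivial Y]

theorem Setting.one_le_kappa (h : Setting f μ ℓ ρ I σ n) : 1 ≤ ℓ / μ := by
  rw [le_div_iff₀ h.mu_pos, one_mul]; exact h.assumptions.le_lipschitz

theorem Setting.ell_pos (h : Setting f μ ℓ ρ I σ n) : 0 < ℓ :=
  h.mu_pos.trans_le h.assumptions.le_lipschitz


theorem Setting.rhobar_pos (h : Setting f μ ℓ ρ I σ n) : 0 < I.ρbar := by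
  have := h.one_le_kappa
  have := h.rho_pos
  rw [h.rhobar_eq]; positivity

theorem Setting.M_pos (h : Setting f μ ℓ ρ I σ n) : 0 < I.M := by
  have := h.rhobar_pos
  have h1 : (0 : ℝ) < I.m := by exact_mod_cast h.m_pos
  exact lt_of_lt_of_le (by positivity) h.M_ge

theorem Setting.rhobar_le (h : Setting f μ ℓ ρ I σ n) : 10000 * I.ρbar ≤ I.M := by
  have h1 : (1 : ℝ) ≤ I.m := by exact_mod_cast h.m_pos
  have := h.rhobar_pos
  refine le_trans ?_ h.M_ge
  nlinarith

/-- Introduces the unit u = √(ε/M), in which gradients scale as M u² and Hessians as M u. -/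
theorem Setting.eps_eq (h : Setting f μ ℓ ρ I σ n) : I.ε = I.M * √(I.ε / I.M) ^ 2 := by
  have h1 := h.M_pos
  have h2 := h.eps_pos
  rw [Real.sq_sqrt (by positivity)]
  field_simp

theorem Setting.innerAccuracy_pos (h : Setting f μ ℓ ρ I σ n) :
    0 < innerAccuracy ℓ ρ I.M I.ε := by
  have h1 := h.M_pos
  have h2 := h.eps_pos
  have h3 := h.ell_pos
  have h4 := h.rho_pos
  unfold innerAccuracy
  positivity

theorem Setting.ell_mul_innerAccuracy_le (h : Setting f μ ℓ ρ I σ n) :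
    ℓ * innerAccuracy ℓ ρ I.M I.ε ≤ I.M * √(I.ε / I.M) ^ 2 / 576 := by
  rw [← h.eps_eq]
  have h3 := h.ell_pos
  calc _ ≤ ℓ * (I.ε / (576 * ℓ)) := by gcongr; exact min_le_left _ _
    _ = _ := by field_simp

/-- The stopping test after taking square roots: linear in the step length and the lag. -/
theorem Setting.stops_iff (h : Setting f μ ℓ ρ I σ n) (S S' : State X Y) :
    Stops I S S' ↔ (I.M + 2 * I.ρbar) / √2 * ‖S'.x - S.x‖ + I.ρbar * ‖S'.xTilde - S.x‖ ≤
      287 / 288 * (I.M * √(I.ε / I.M)) := by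
  have hM := h.M_pos
  have hρ := h.rhobar_pos
  unfold Stops
  set D := (I.M + 2 * I.ρbar) / √2 * ‖S'.x - S.x‖ + I.ρbar * ‖S'.xTilde - S.x‖ with hD
  have hD0 : 0 ≤ D := by positivity
  rw [ge_iff_le, ← sq_le_sq₀ hD0 (by positivity)]
  have e := h.eps_eq
  generalize √(I.ε / I.M) = u at e ⊢
  rw [e, one_div, mul_assoc, inv_mul_le_iff₀ hM]
  constructor <;> intro h1 <;> nlinarith

variable [FiniteDimensional ℝ Y]

/-- The inner loop reaches its target accuracy in every iteration. -/
theorem Setting.accuracy (h : Setting f μ ℓ ρ I σ n) {t : ℕ} (ht : t < n) :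
    ‖(σ (t + 1)).y - yStar f (σ t).x‖ ≤ innerAccuracy ℓ ρ I.M I.ε := by
  have hloop : ∀ t < n, (σ (t + 1)).y = (agd (fun y => -f (pair (σ t).x y)) (σ t).y (I.K t) (1 / ℓ)
      ((√(ℓ / μ) - 1) / (√(ℓ / μ) + 1))).z := fun t ht => by
    rw [(h.run.iteration t ht).y_eq, innerLoop, h.kappa_eq, h.ell_eq]
  induction t with
  | zero =>
    rw [hloop 0 ht]
    refine h.assumptions.norm_innerLoop_sub_le h.mu_pos h.innerAccuracy_pos (le_of_eq ?_)
      (h.kappa_eq ▸ h.schedule.zero)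
    rw [h.run.init]
    simp [initState]
  | succ t ih =>
    rw [hloop (t + 1) ht]
    refine h.assumptions.norm_innerLoop_sub_le h.mu_pos h.innerAccuracy_pos ?_
      (h.kappa_eq ▸ h.schedule.succ t ht)
    -- Warm start: `(σ (t + 1)).y` is y_t, within the target accuracy of y*(x_t), and y* moves by at
    -- most κ times the step.
    have h1 := h.assumptions.norm_yStar_sub_le h.mu_pos (σ t).x (σ (t + 1)).x
    rw [norm_sub_rev (σ t).x] at h1
    have h2 := ih (by omega)
    have h3 := norm_add_le ((σ (t + 1)).y - yStar f (σ t).x)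
      (yStar f (σ t).x - yStar f (σ (t + 1)).x)
    rw [sub_add_sub_cancel] at h3
    linarith

theorem Setting.gradient_error (h : Setting f μ ℓ ρ I σ n) {t : ℕ} (ht : t < n) :
    ‖gradX f (σ t).x (σ (t + 1)).y - gradient (primal f) (σ t).x‖ ≤
      I.M * √(I.ε / I.M) ^ 2 / 576 := by
  refine (h.assumptions.norm_gradX_sub_gradient_primal_le h.mu_pos _ _).trans
    (le_trans ?_ h.ell_mul_innerAccuracy_le)
  have := h.ell_pos
  gcongr
  exact h.accuracy ht

/-- The squared error is at most 16κ³ρ · ℓε̃, with ℓε̃ ≤ M u²/576 and κ³ρ ≤ M/50000. Thus the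
gradient part of ε̃ alone controls the Hessian error. -/
theorem Setting.hessian_error (h : Setting f μ ℓ ρ I σ n) {t : ℕ} (ht : t < n) :
    ‖(σ (t + 1)).HTilde - hessian (primal f) (σ (t + 1)).xTilde‖ ≤
      I.M * √(I.ε / I.M) / 1000 := by
  obtain ⟨e1, e2⟩ := h.snapshot ht
  have hM := h.M_pos
  have hℓ := h.ell_pos
  have hκ := h.one_le_kappa
  have hρ := h.rho_pos
  rw [e1, e2]
  refine le_of_sq_le_sq ?_ (by positivity)
  refine (h.assumptions.sq_norm_schurHessian_sub_hessian_primal_le h.mu_pos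
    h.assumptions.le_lipschitz h.rho_pos.le _ _).trans ?_
  have h1 := h.accuracy (t := t - t % I.m) (by omega)
  have h2 : ℓ * ‖(σ (t - t % I.m + 1)).y - yStar f (σ (t - t % I.m)).x‖ ≤
      I.M * √(I.ε / I.M) ^ 2 / 576 := le_trans (by gcongr) h.ell_mul_innerAccuracy_le
  have h3 : 50000 * ((ℓ / μ) ^ 3 * ρ) ≤ I.M := by
    refine le_trans ?_ h.rhobar_le
    rw [h.rhobar_eq]
    have hsq : 7 / 5 ≤ √2 := Real.le_sqrt_of_sq_le (by norm_num)
    have : 0 ≤ (ℓ / μ) ^ 3 * ρ := by positivity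
    nlinarith
  calc _ ≤ 16 * (ℓ / μ) ^ 3 * ρ * (I.M * √(I.ε / I.M) ^ 2 / 576) := by gcongr
    _ = ((ℓ / μ) ^ 3 * ρ) * (I.M * √(I.ε / I.M) ^ 2 / 36) := by ring
    _ ≤ (I.M / 50000) * (I.M * √(I.ε / I.M) ^ 2 / 36) := by gcongr; linarith
    _ ≤ _ := by
      have : 0 ≤ (I.M * √(I.ε / I.M)) ^ 2 := by positivity
      nlinarith

theorem Setting.primal_facts (h : Setting f μ ℓ ρ I σ n) :
    (∀ x, HasGradientAt (primal f) (gradient (primal f) x) x) ∧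
    (∀ x, HasFDerivAt (gradient (primal f)) (hessian (primal f) x) x) ∧
    (∀ x x', ‖hessian (primal f) x - hessian (primal f) x'‖ ≤ I.ρbar * ‖x - x'‖) := by
  refine ⟨fun x => ?_, fun x => ?_, fun x x' => ?_⟩
  · rw [h.assumptions.gradient_primal h.mu_pos]
    exact h.assumptions.hasGradientAt_primal h.mu_pos x
  · rw [h.assumptions.hessian_primal h.mu_pos]
    exact h.assumptions.hasFDerivAt_gradient_primal h.mu_pos x
  · rw [h.rhobar_eq]
    exact h.assumptions.norm_hessian_primal_sub_le h.mu_pos h.assumptions.le_lipschitz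
      h.rho_pos.le x x'

/-- A point at which the method stops is second-order stationary. -/
theorem Setting.stationary (h : Setting f μ ℓ ρ I σ n) {t : ℕ} (ht : t < n)
    (hs : Stops I (σ t) (σ (t + 1))) :
    ‖gradient (primal f) (σ (t + 1)).x‖ ≤ I.ε ∧
      ∀ v, -√(I.M * I.ε) * ‖v‖ ^ 2 ≤ inner ℝ v (hessian (primal f) (σ (t + 1)).x v) := by
  obtain ⟨-, hH, hLip⟩ := h.primal_facts
  have hM := h.M_pos
  have key := stationary_of_stop h.rhobar_pos.le hM (Real.sqrt_nonneg _) hH hLip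
    (h.snapshot_symm ht) (h.gradient_error ht) (h.hessian_error ht)
    (h.run.iteration t ht).argmin ((h.stops_iff _ _).1 hs)
  rw [add_sub_cancel, ← h.eps_eq] at key
  have e : √(I.M * I.ε) = I.M * √(I.ε / I.M) := by
    rw [show I.M * I.ε = I.M ^ 2 * (I.ε / I.M) by field_simp, Real.sqrt_mul (by positivity),
      Real.sqrt_sq hM.le]
  rwa [e]

/-- The total descent over `k` iterations that do not pass the stopping test. -/
theorem Setting.descent (h : Setting f μ ℓ ρ I σ n) {k : ℕ} (hk : k ≤ n)
    (hs : ∀ t < k, ¬ Stops I (σ t) (σ (t + 1))) :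
    I.M * ∑ t ∈ Finset.range k, ‖(σ (t + 1)).x - (σ t).x‖ ^ 3 ≤
        8 * (primal f I.x₀ - ⨅ x, primal f x) ∧
      k * (I.M * √(I.ε / I.M) ^ 3) ≤ 40 * (primal f I.x₀ - ⨅ x, primal f x) := by
  obtain ⟨hG, hH, hLip⟩ := h.primal_facts
  have hM := h.M_pos
  have hρ := h.rhobar_pos
  set r : ℕ → ℝ := fun t => ‖(σ (t + 1)).x - (σ t).x‖ with hr
  set b : ℕ → ℝ := fun t => ‖(σ (t + 1)).xTilde - (σ t).x‖ with hb
  set S := ∑ t ∈ Finset.range k, r t ^ 3 with hS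
  have hS0 : 0 ≤ S := Finset.sum_nonneg fun t _ => by positivity
  have hstep : ∀ t < k, primal f (σ (t + 1)).x - primal f (σ t).x ≤
      I.M * (-(9 / 50 * r t ^ 3) + 51 * (I.ρbar / I.M * b t) ^ 3) ∧
      √(I.ε / I.M) ^ 3 ≤ 4 * r t ^ 3 + 32 * (I.ρbar / I.M * b t) ^ 3 := by
    intro t ht
    have key := descent_of_not_stop hρ.le hM h.rhobar_le (Real.sqrt_nonneg _) hG hH hLip
      (h.snapshot_symm (ht.trans_le hk)) (h.gradient_error (ht.trans_le hk))
      (h.hessian_error (ht.trans_le hk)) (h.run.iteration t (ht.trans_le hk)).argmin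
      (not_le.1 (mt (h.stops_iff _ _).2 (hs t ht))).le
    rwa [add_sub_cancel] at key
  have hbsum : ∑ t ∈ Finset.range k, b t ^ 3 ≤ (I.m : ℝ) ^ 3 * S := by
    refine sum_cube_window_le h.m_pos (fun t => norm_nonneg _) (fun t => norm_nonneg _) ?_
    intro t ht
    have h1 := dist_le_Ico_sum_dist (fun t => (σ t).x) (Nat.sub_le t (t % I.m))
    simp only [hb, (h.snapshot (ht.trans_le hk)).1, ← dist_eq_norm]
    refine h1.trans (le_of_eq (Finset.sum_congr rfl fun j _ => ?_))
    rw [dist_comm, dist_eq_norm]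
  -- The factor m³ from the windows meets (ρ̄/M)³, and mρ̄/M ≤ 10⁻⁴.
  have hE : ∑ t ∈ Finset.range k, (I.ρbar / I.M * b t) ^ 3 ≤ S / 1000000000000 := by
    simp only [mul_pow, ← Finset.mul_sum]
    have h1 : I.m * (I.ρbar / I.M) ≤ 1 / 10000 := by
      rw [← mul_div_assoc, div_le_iff₀ hM]
      linarith [h.M_ge]
    calc _ ≤ (I.ρbar / I.M) ^ 3 * ((I.m : ℝ) ^ 3 * S) := by gcongr
      _ = (I.m * (I.ρbar / I.M)) ^ 3 * S := by ring
      _ ≤ (1 / 10000) ^ 3 * S := by gcongr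
      _ = _ := by ring
  have hsum1 : primal f (σ k).x - primal f (σ 0).x ≤
      I.M * (-(9 / 50 * S) + 51 * (S / 1000000000000)) := by
    rw [← Finset.sum_range_sub (fun t => primal f (σ t).x)]
    refine (Finset.sum_le_sum fun t ht => (hstep t (Finset.mem_range.1 ht)).1).trans ?_
    rw [← Finset.mul_sum, Finset.sum_add_distrib, Finset.sum_neg_distrib, ← Finset.mul_sum,
      ← Finset.mul_sum]
    gcongr
  have hsum2 : k * √(I.ε / I.M) ^ 3 ≤ 4 * S + 32 * (S / 1000000000000) := by
    have h1 := Finset.sum_le_sum fun t ht => (hstep t (Finset.mem_range.1 ht)).2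
    rw [Finset.sum_const, Finset.card_range, nsmul_eq_mul, Finset.sum_add_distrib,
      ← Finset.mul_sum, ← Finset.mul_sum] at h1
    refine h1.trans ?_
    gcongr
  have hinf : ⨅ x, primal f x ≤ primal f (σ k).x := ciInf_le h.assumptions.bddBelow _
  have hx0 : (σ 0).x = I.x₀ := by rw [h.run.init]; rfl
  rw [hx0] at hsum1
  have hMS : 0 ≤ I.M * S := by positivity
  -- The coefficient 9/50, less the absorbed lag, exceeds 1/8; the count then follows from 4 · 8
  -- plus a negligible term being at most 40.
  have h8 : I.M * S ≤ 8 * (primal f I.x₀ - ⨅ x, primal f x) := by linarith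
  refine ⟨h8, ?_⟩
  have h9 := mul_le_mul_of_nonneg_left hsum2 hM.le
  linarith

/-- If the iteration limit is large, the method ends by the stopping test. -/
theorem Setting.stops_last (h : Setting f μ ℓ ρ I σ n)
    (hT : 40 * (primal f I.x₀ - ⨅ x, primal f x) < I.T * (I.M * √(I.ε / I.M) ^ 3)) :
    Stops I (σ (n - 1)) (σ n) := by
  by_contra hns
  have hn : n = I.T := h.run.ends.resolve_right hns
  have hpos := h.run.pos
  have h1 := (h.descent le_rfl fun t ht => by
    rcases eq_or_ne (t + 1) n with he | he
    · rw [show n - 1 = t by omega, ← he] at hns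
      exact hns
    · exact h.run.continues t (by omega)).2
  rw [hn] at h1
  linarith

end Run

/-! ### Counting oracle calls. -/

section Cost

variable {X Y : Type} [NormedAddCommGroup X] [NormedAddCommGroup Y]
  [InnerProductSpace ℝ X] [InnerProductSpace ℝ Y] [CompleteSpace X] [CompleteSpace Y]
  {f : Joint X Y → ℝ} {μ ℓ ρ : ℝ} {I : Input X} {σ : ℕ → State X Y} {n : ℕ}

theorem Setting.firstCalls_eq (h : Setting f μ ℓ ρ I σ n) {k : ℕ} (hk : k ≤ n) :
    (σ k).firstCalls = ∑ t ∈ Finset.range k, (I.K t + 1) := by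
  induction k with
  | zero => rw [h.run.init]; rfl
  | succ k ih =>
    rw [(h.run.iteration k hk).firstCalls_eq, Finset.sum_range_succ, ih (by omega), innerLoop,
      agd_calls, add_assoc]

/-- Among 0, …, k there are ⌊k/m⌋ + 1 multiples of m, each costing four blocks. -/
theorem Setting.secondCalls_eq (h : Setting f μ ℓ ρ I σ n) {k : ℕ} (hk : k < n) :
    (σ (k + 1)).secondCalls = 4 * (k / I.m + 1) := by
  induction k with
  | zero =>
    rw [(h.run.iteration 0 hk).secondCalls_eq, h.run.init]
    simp [initState]
  | succ k ih =>
    rw [(h.run.iteration (k + 1) hk).secondCalls_eq, ih (by omega), Nat.succ_div]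
    simp only [Nat.dvd_iff_mod_eq_zero]
    split_ifs <;> ring

/-- The number of inner steps in a later iteration, with the length `r` of the previous step. -/
theorem ceil_le_of_step {κ e u r Lg β : ℝ} (hκ : 1 ≤ κ) (he : 0 < e) (hu : 0 < u) (hr : 0 ≤ r)
    (hκL : Real.log (√(κ + 1)) ≤ Lg) (hA : Real.log (1 + κ * u / e) ≤ β * Lg) :
    (⌈2 * √κ * Real.log (√(κ + 1) / e * (e + κ * r))⌉₊ : ℝ) ≤
      1 + 2 * √κ * (Lg + β * Lg + 1 + r ^ 3 / u ^ 3) := by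
  have hq : 1 ≤ √(κ + 1) := Real.one_le_sqrt.2 (by linarith)
  have hw : 0 ≤ r / u := by positivity
  have hA0 : 0 ≤ κ * u / e := by positivity
  have e1 : √(κ + 1) / e * (e + κ * r) = √(κ + 1) * (1 + κ * u / e * (r / u)) := by
    field_simp
  have h1 : 1 ≤ 1 + κ * u / e * (r / u) := by nlinarith [mul_nonneg hA0 hw]
  have h2 : Real.log (1 + κ * u / e * (r / u)) ≤ β * Lg + (1 + (r / u) ^ 3) := by
    -- The product separates a fixed logarithm from the dependence on the step; `h5` then bounds the
    -- latter by a cube, the quantity that descent sums.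
    have h3 : 1 + κ * u / e * (r / u) ≤ (1 + κ * u / e) * (1 + r / u) := by nlinarith
    refine (Real.log_le_log (by linarith) h3).trans ?_
    rw [Real.log_mul (by positivity) (by positivity)]
    have h4 : Real.log (1 + r / u) ≤ r / u := by
      have := Real.log_le_sub_one_of_pos (show 0 < 1 + r / u by positivity)
      linarith
    have h5 : r / u ≤ 1 + (r / u) ^ 3 := by
      rcases le_total (r / u) 1 with h | h
      · have := pow_nonneg hw 3; linarith
      · have := le_self_pow₀ h three_ne_zero; linarith
    linarith
  have hlog0 : 0 ≤ Real.log (√(κ + 1) / e * (e + κ * r)) := by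
    rw [e1]; exact Real.log_nonneg (one_le_mul_of_one_le_of_one_le hq h1)
  have h6 : Real.log (√(κ + 1) / e * (e + κ * r)) ≤ Lg + β * Lg + 1 + r ^ 3 / u ^ 3 := by
    rw [e1, Real.log_mul (by positivity) (by positivity), ← div_pow]
    linarith
  refine (Nat.ceil_lt_add_one (by positivity)).le.trans ?_
  rw [add_comm]
  gcongr

variable [Nontrivial Y] [FiniteDimensional ℝ Y]

/-- The cost of a run, in terms of a bound `W` on the number of iterations and of a logarithmic
factor `Lg`. -/
theorem Setting.cost_le (h : Setting f μ ℓ ρ I σ n) {N d W Lg β γ : ℝ} (hN : 0 ≤ N) (hd0 : 0 ≤ d)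
    (hd : d ≤ √(ℓ / μ) * I.m) (hL : 1 ≤ Lg) (hβ : 0 ≤ β) (hγ : 0 ≤ γ)
    (hW : W * (I.M * √(I.ε / I.M) ^ 3) = primal f I.x₀ - ⨅ x, primal f x)
    (hκL : Real.log (√(ℓ / μ + 1)) ≤ Lg)
    (hA : Real.log (1 + ℓ / μ * √(I.ε / I.M) / innerAccuracy ℓ ρ I.M I.ε) ≤ β * Lg)
    (h0 : Real.log (√(ℓ / μ + 1) / innerAccuracy ℓ ρ I.M I.ε * ‖yStar f I.x₀‖) ≤ γ * Lg) :
    cost N d (σ n) ≤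
      N * ((2 + 2 * γ) * √(ℓ / μ) + 4 * d + (416 + 80 * β) * (√(ℓ / μ) * W)) * Lg := by
  -- The first k iterations fail the test, and only their step lengths enter the inner loops. The
  -- last one may pass, so descent is applied to k.
  obtain ⟨k, rfl⟩ : ∃ k, n = k + 1 := ⟨n - 1, by have := h.run.pos; omega⟩
  have hM := h.M_pos
  have hε := h.eps_pos
  have hκ := h.one_le_kappa
  have hs : 1 ≤ √(ℓ / μ) := Real.one_le_sqrt.2 hκ
  have hu : 0 < √(I.ε / I.M) := by positivity
  have he := h.innerAccuracy_pos
  have hm : (0 : ℝ) < I.m := by exact_mod_cast h.m_pos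
  have hx0 : (σ 0).x = I.x₀ := by rw [h.run.init]; rfl
  set u := √(I.ε / I.M) with hu_def
  set s := √(ℓ / μ) with hs_def
  set r : ℕ → ℝ := fun t => ‖(σ (t + 1)).x - (σ t).x‖ with hr
  obtain ⟨d1, d2⟩ := h.descent (k := k) (by omega) fun t ht => h.run.continues t (by omega)
  rw [← hW] at d1 d2
  rw [← hu_def] at d2
  have hv : 0 < I.M * u ^ 3 := by positivity
  have hkW : (k : ℝ) ≤ 40 * W := by
    refine le_of_mul_le_mul_right (?_ : (k : ℝ) * (I.M * u ^ 3) ≤ _) hv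
    linarith
  have hW0 : 0 ≤ W := by have := Nat.cast_nonneg (α := ℝ) k; linarith
  have hsum : ∑ t ∈ Finset.range k, r t ^ 3 / u ^ 3 ≤ 8 * W := by
    rw [← Finset.sum_div, div_le_iff₀ (by positivity)]
    refine le_of_mul_le_mul_left (?_ : I.M * _ ≤ I.M * _) hM
    linarith
  have hK0 : (I.K 0 : ℝ) ≤ 1 + 2 * s * (γ * Lg) := by
    rw [h.schedule.zero, h.kappa_eq, hx0]
    have hnn : 0 ≤ 2 * s * (γ * Lg) := by positivity
    have h1 : 2 * s * Real.log (√(ℓ / μ + 1) / innerAccuracy ℓ ρ I.M I.ε * ‖yStar f I.x₀‖) ≤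
        2 * s * (γ * Lg) := by gcongr
    calc _ ≤ ((⌈2 * s * (γ * Lg)⌉₊ : ℕ) : ℝ) := by exact_mod_cast Nat.ceil_mono h1
      _ ≤ 2 * s * (γ * Lg) + 1 := (Nat.ceil_lt_add_one hnn).le
      _ = _ := by ring
  have hKt : ∀ t < k, (I.K (t + 1) : ℝ) ≤
      1 + 2 * s * (Lg + β * Lg + 1 + r t ^ 3 / u ^ 3) := by
    intro t ht
    rw [h.schedule.succ t (by omega), h.kappa_eq]
    exact ceil_le_of_step hκ he hu (norm_nonneg _) hκL hA
  have hfirst : ((σ (k + 1)).firstCalls : ℝ) ≤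
      1 + 2 * s * (γ * Lg) + 1 + (2 * k + 2 * s * (k * (Lg + β * Lg + 1) + 8 * W)) := by
    rw [h.firstCalls_eq le_rfl, Finset.sum_range_succ']
    push_cast
    have h1 : ∑ t ∈ Finset.range k, ((I.K (t + 1) : ℝ) + 1) ≤
        ∑ t ∈ Finset.range k, (2 + 2 * s * (Lg + β * Lg + 1) + 2 * s * (r t ^ 3 / u ^ 3)) := by
      refine Finset.sum_le_sum fun t ht => ?_
      have := hKt t (Finset.mem_range.1 ht)
      linarith
    rw [Finset.sum_add_distrib (f := fun _ => 2 + 2 * s * (Lg + β * Lg + 1)), Finset.sum_const,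
      Finset.card_range, nsmul_eq_mul, ← Finset.mul_sum] at h1
    have h2 := mul_le_mul_of_nonneg_left hsum (show 0 ≤ 2 * s by positivity)
    linarith
  have hsecond : d * ((σ (k + 1)).secondCalls : ℝ) ≤ 4 * d + 160 * (s * W) := by
    rw [h.secondCalls_eq (Nat.lt_succ_self k)]
    push_cast
    have h1 : ((k / I.m : ℕ) : ℝ) ≤ k / I.m := Nat.cast_div_le
    -- The balance behind m ≈ d/√κ: per iteration, the snapshots cost no more than order √κ
    -- gradients.
    have h2 : d * (k / I.m : ℝ) ≤ s * k := by
      rw [← mul_div_assoc, div_le_iff₀ hm]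
      nlinarith [Nat.cast_nonneg (α := ℝ) k]
    have h3 := mul_le_mul_of_nonneg_left h1 hd0
    have h4 := mul_le_mul_of_nonneg_left hkW (show 0 ≤ s by positivity)
    linarith
  have hLs : 1 ≤ s * Lg := one_le_mul_of_one_le_of_one_le hs hL
  have hsW : 0 ≤ s * W := by positivity
  have b1 : (k : ℝ) * (Lg + β * Lg + 1) ≤ 40 * W * ((2 + β) * Lg) := by
    gcongr
    linarith
  have b2 : 2 * (k : ℝ) ≤ 80 * (s * W * Lg) := by
    have : W * 1 ≤ W * (s * Lg) := by gcongr
    linarith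
  have b3 : s * W ≤ s * W * Lg := le_mul_of_one_le_right hsW hL
  have b4 : d ≤ d * Lg := le_mul_of_one_le_right hd0 hL
  have b5 := mul_le_mul_of_nonneg_left b1 (show 0 ≤ 2 * s by positivity)
  have total : ((σ (k + 1)).firstCalls : ℝ) + d * ((σ (k + 1)).secondCalls : ℝ) ≤
      ((2 + 2 * γ) * s + 4 * d + (416 + 80 * β) * (s * W)) * Lg := by
    linarith
  calc cost N d (σ (k + 1)) = N * (((σ (k + 1)).firstCalls : ℝ) +
        d * ((σ (k + 1)).secondCalls : ℝ)) := by unfold cost; ring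
    _ ≤ N * (((2 + 2 * γ) * s + 4 * d + (416 + 80 * β) * (s * W)) * Lg) := by gcongr
    _ = _ := by ring

end Cost

/-! ### Existence of runs. -/

section Existence

variable {X Y : Type} [NormedAddCommGroup X] [NormedAddCommGroup Y]
  [InnerProductSpace ℝ X] [InnerProductSpace ℝ Y] [CompleteSpace X] [CompleteSpace Y]

theorem exists_isIteration [FiniteDimensional ℝ X] (f : Joint X Y → ℝ) {I : Input X}
    (hM : 0 < I.M) (t : ℕ) (S : State X Y) : ∃ S', IsIteration f I t S S' := by
  set y := (innerLoop f I t S).z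
  set H := if t % I.m = 0 then schurHessian f S.x y else S.HTilde with hH
  obtain ⟨s, hs⟩ := exists_cubicModel_min (gradX f S.x y) H hM
  refine ⟨⟨S.x + s, y, if t % I.m = 0 then S.x else S.xTilde, H,
    S.firstCalls + (innerLoop f I t S).calls + 1,
    S.secondCalls + if t % I.m = 0 then 4 else 0⟩, ⟨rfl, rfl, rfl, ?_, rfl, rfl⟩⟩
  simpa using hs

/-- Complete runs with the prescribed numbers of inner steps exist. -/
theorem exists_run [FiniteDimensional ℝ X] (f : Joint X Y → ℝ) (x₀ : X) {T : ℕ} (hT : 1 ≤ T)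
    (κ ℓ δ : ℝ) (m : ℕ) {M : ℝ} (hM : 0 < M) (ρbar e : ℝ) :
    ∃ (K : ℕ → ℕ) (σ : ℕ → State X Y) (n : ℕ),
      IsRun f ⟨x₀, T, K, κ, ℓ, δ, m, M, ρbar⟩ σ n ∧ IsSchedule f κ e K σ n := by
  have hstep : ∀ (k t : ℕ) (S : State X Y),
      ∃ S', IsIteration f ⟨x₀, T, fun _ => k, κ, ℓ, δ, m, M, ρbar⟩ t S S' :=
    fun k t S => exists_isIteration f hM t S
  choose next hnext using hstep
  -- K_{t+1} depends on x_{t+1}, so states and inner iteration numbers are built in one recursion.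
  -- Iteration t reads only K t, so a constant schedule can stand in for it.
  let w : ℕ → State X Y × ℕ := fun t => Nat.rec
    (initState x₀, ⌈2 * √κ * Real.log (√(κ + 1) / e * ‖yStar f x₀‖)⌉₊)
    (fun t p => (next p.2 t p.1, ⌈2 * √κ * Real.log (√(κ + 1) / e *
      (e + κ * ‖(next p.2 t p.1).x - p.1.x‖))⌉₊)) t
  have hiter : ∀ t, IsIteration f ⟨x₀, T, fun t => (w t).2, κ, ℓ, δ, m, M, ρbar⟩ t
      (w t).1 (w (t + 1)).1 := by
    intro t
    have h := hnext (w t).2 t (w t).1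
    exact ⟨h.y_eq, h.xTilde_eq, h.HTilde_eq, h.argmin, h.firstCalls_eq, h.secondCalls_eq⟩
  -- The run ends at the least n with this property; minimality gives that all earlier tests fail.
  let P : ℕ → Prop := fun n => 1 ≤ n ∧ (n = T ∨
    Stops ⟨x₀, T, fun t => (w t).2, κ, ℓ, δ, m, M, ρbar⟩ (w (n - 1)).1 (w n).1)
  have hex : ∃ n, P n := ⟨T, hT, Or.inl rfl⟩
  classical
  refine ⟨fun t => (w t).2, fun t => (w t).1, Nat.find hex,
    ⟨rfl, (Nat.find_spec hex).1, Nat.find_min' hex ⟨hT, Or.inl rfl⟩, fun t _ => hiter t,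
      fun t ht hs => Nat.find_min hex ht ⟨by omega, Or.inr hs⟩, (Nat.find_spec hex).2⟩,
    ⟨rfl, fun t _ => rfl⟩⟩

end Existence

/-! ### From quadratic form bounds to the least eigenvalue. -/

section SOSP

variable {X Y : Type} [NormedAddCommGroup X] [NormedAddCommGroup Y]
  [InnerProductSpace ℝ X] [InnerProductSpace ℝ Y]

/-- A lower bound for a symmetric operator bounds its least eigenvalue. -/
theorem exists_isLeast_eigenvalue [FiniteDimensional ℝ X] [Nontrivial X] {H : X →L[ℝ] X} {τ : ℝ}
    (hsym : ∀ v w, inner ℝ (H v) w = inner ℝ v (H w))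
    (hH : ∀ v, -τ * ‖v‖ ^ 2 ≤ inner ℝ v (H v)) :
    ∃ lam : ℝ, IsLeast {c : ℝ | Module.End.HasEigenvalue (H : X →ₗ[ℝ] X) c} lam ∧ -τ ≤ lam := by
  have hs : (H : X →ₗ[ℝ] X).IsSymmetric := hsym
  have hne : {c : ℝ | Module.End.HasEigenvalue (H : X →ₗ[ℝ] X) c}.Nonempty :=
    ⟨_, hs.hasEigenvalue_iInf_of_finiteDimensional⟩
  have hfin : {c : ℝ | Module.End.HasEigenvalue (H : X →ₗ[ℝ] X) c}.Finite :=
    Module.End.finite_hasEigenvalue _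
  obtain ⟨lam, hlam, hmin⟩ := Set.exists_min_image _ id hfin hne
  refine ⟨lam, ⟨hlam, hmin⟩, ?_⟩
  obtain ⟨v, hv⟩ := Module.End.HasEigenvalue.exists_hasEigenvector hlam
  have h1 := hH v
  have h2 : H v = lam • v := hv.apply_eq_smul
  have h3 : 0 < ‖v‖ ^ 2 := by have := norm_pos_iff.2 hv.2; positivity
  rw [h2, inner_smul_right, real_inner_self_eq_norm_sq] at h1
  exact le_of_mul_le_mul_right h1 h3

variable [CompleteSpace X] [CompleteSpace Y]

theorem Assumptions.isSOSP [FiniteDimensional ℝ X] [Nontrivial X] [FiniteDimensional ℝ Y]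
    {f : Joint X Y → ℝ} {μ ℓ ρ ε τ : ℝ} (hf : Assumptions f μ ℓ ρ) (hμ : 0 < μ) {x : X}
    (hg : ‖gradient (primal f) x‖ ≤ ε)
    (hH : ∀ v, -τ * ‖v‖ ^ 2 ≤ inner ℝ v (hessian (primal f) x v)) :
    IsSOSP (primal f) ε τ x where
  differentiable := Eventually.of_forall fun z => (hf.hasGradientAt_primal hμ z).differentiableAt
  twice_differentiable := (hf.hasFDerivAt_gradient_primal hμ x).differentiableAt
  gradient_le := hg
  lambdaMin_ge := exists_isLeast_eigenvalue (fun v w => by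
    rw [hf.hessian_primal hμ]; exact hf.inner_schurHessian_symm hμ _ _ v w) hH

theorem IsSOSP.mono {φ : X → ℝ} {ε ε' τ τ' : ℝ} {x : X} (h : IsSOSP φ ε τ x) (hε : ε ≤ ε')
    (hτ : τ ≤ τ') : IsSOSP φ ε' τ' x where
  differentiable := h.differentiable
  twice_differentiable := h.twice_differentiable
  gradient_le := h.gradient_le.trans hε
  lambdaMin_ge := h.lambdaMin_ge.imp fun _ hl => ⟨hl.1, by linarith [hl.2]⟩

end SOSP

/-! ### Logarithmic factors and powers of κ, d, ρ. -/

section Numerics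

/-- The reciprocal of a minimum is at most the sum of the reciprocals. -/
theorem div_innerAccuracy_le {ℓ ρ M δ x : ℝ} (hℓ : 0 < ℓ) (hρ : 0 < ρ) (hM : 0 < M) (hδ : 0 < δ)
    (hx : 0 ≤ x) :
    x / innerAccuracy ℓ ρ M δ ≤ 576 * (ℓ * x / δ) + 288 * (ρ * x / √(M * δ)) := by
  have hq : 0 < √(M * δ) := by positivity
  have h1 : 0 ≤ 576 * (ℓ * x / δ) := by positivity
  have h2 : 0 ≤ 288 * (ρ * x / √(M * δ)) := by positivity
  unfold innerAccuracy
  rcases min_choice (δ / (576 * ℓ)) (√(M * δ) / (288 * ρ)) with h | h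
  · rw [h]
    have : x / (δ / (576 * ℓ)) = 576 * (ℓ * x / δ) := by field_simp
    linarith
  · rw [h]
    have : x / (√(M * δ) / (288 * ρ)) = 288 * (ρ * x / √(M * δ)) := by field_simp
    linarith

/-- The argument of the logarithm in the cost bound. -/
noncomputable def logArg (κ ℓ ρ ε y : ℝ) : ℝ :=
  2 + κ + ℓ ^ 2 / (ρ * ε) + ℓ * y / ε + ρ * y ^ 2 / ε

/-- The summand 2 + κ ≥ 3 > e makes the logarithm at least 1, so additive constants can be absorbed
into it. -/
theorem logArg_facts {κ ℓ ρ ε y : ℝ} (hκ : 1 ≤ κ) (hℓ : 0 < ℓ) (hρ : 0 < ρ) (hε : 0 < ε)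
    (hy : 0 ≤ y) : 3 ≤ logArg κ ℓ ρ ε y ∧ κ + 1 ≤ logArg κ ℓ ρ ε y ∧
      ℓ ^ 2 / (ρ * ε) ≤ logArg κ ℓ ρ ε y ∧ ℓ * y / ε ≤ logArg κ ℓ ρ ε y ∧
      ρ * y ^ 2 / ε ≤ logArg κ ℓ ρ ε y ∧ 1 ≤ Real.log (logArg κ ℓ ρ ε y) := by
  have h1 : 0 ≤ ℓ ^ 2 / (ρ * ε) := by positivity
  have h2 : 0 ≤ ℓ * y / ε := by positivity
  have h3 : 0 ≤ ρ * y ^ 2 / ε := by positivity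
  have h4 : 3 ≤ logArg κ ℓ ρ ε y := by unfold logArg; linarith
  refine ⟨h4, ?_, ?_, ?_, ?_, ?_⟩
  · unfold logArg; linarith
  · unfold logArg; linarith
  · unfold logArg; linarith
  · unfold logArg; linarith
  · rw [Real.le_log_iff_exp_le (by linarith)]
    linarith [Real.exp_one_lt_three]

theorem log_sqrt_le {κ ℓ ρ ε y : ℝ} (hκ : 1 ≤ κ) (hℓ : 0 < ℓ) (hρ : 0 < ρ) (hε : 0 < ε)
    (hy : 0 ≤ y) : √(κ + 1) ≤ logArg κ ℓ ρ ε y := by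
  obtain ⟨-, h, -⟩ := logArg_facts hκ hℓ hρ hε hy
  exact (Real.sqrt_le_self_iff.2 (Or.inr (by linarith))).trans h

/-- The quotient of a quantity by `√(M δ)` is controlled by the square of the quantity. -/
theorem div_sqrt_le {z M a ε Λ : ℝ} (hM : 0 < M) (ha : 0 < a) (ha1 : a ≤ 1)
    (hε : 0 < ε) (hΛ : 1 ≤ Λ) (h : z ^ 2 ≤ Λ * (M * ε)) : z / √(M * (a * ε)) ≤ Λ / a := by
  rw [div_le_iff₀ (by positivity)]
  refine le_of_sq_le_sq ?_ (by positivity)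
  rw [mul_pow, Real.sq_sqrt (by positivity), div_pow]
  have e : Λ ^ 2 / a ^ 2 * (M * (a * ε)) = Λ * (M * ε) * (Λ / a) := by field_simp
  rw [e]
  refine h.trans (le_mul_of_one_le_right (by positivity) ?_)
  rw [le_div_iff₀ ha]; linarith

/-- Uses log(c/a) ≤ c/a - 1 and log Λ ≥ 1; the case z = 0 is covered by `Real.log 0 = 0`. -/
theorem log_le_of_le_mul_pow {z c a Λ : ℝ} (k : ℕ) (hz : 0 ≤ z) (hc : 0 < c) (ha : 0 < a)
    (hΛ : 1 ≤ Real.log Λ) (hΛ0 : 0 < Λ) (h : z ≤ c / a * Λ ^ k) :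
    Real.log z ≤ (k + c / a) * Real.log Λ := by
  have hca : 0 < c / a := by positivity
  rcases hz.eq_or_lt with h0 | h0
  · rw [← h0, Real.log_zero]; positivity
  · refine (Real.log_le_log h0 h).trans ?_
    rw [Real.log_mul (by positivity) (by positivity), Real.log_pow]
    have h1 := Real.log_le_sub_one_of_pos hca
    nlinarith

/-- Since M ≥ κ³ρ, the two quotients from `div_innerAccuracy_le` are at most Λ/a and 1; the constant
is 865 = 1 + 576 + 288. -/
theorem log_step_le {κ ℓ ρ ε y a M : ℝ} (hκ : 1 ≤ κ) (hℓ : 0 < ℓ) (hρ : 0 < ρ) (hε : 0 < ε)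
    (hy : 0 ≤ y) (ha : 0 < a) (ha1 : a ≤ 1) (hM : κ ^ 3 * ρ ≤ M) :
    Real.log (1 + κ * √(a * ε / M) / innerAccuracy ℓ ρ M (a * ε)) ≤
      (1 + 865 / a) * Real.log (logArg κ ℓ ρ ε y) := by
  obtain ⟨f1, -, f3, -, -, f6⟩ := logArg_facts hκ hℓ hρ hε hy
  set Λ := logArg κ ℓ ρ ε y
  have hM0 : 0 < M := lt_of_lt_of_le (by positivity) hM
  have hδ : 0 < a * ε := by positivity
  set q := √(M * (a * ε)) with hq
  have hq0 : 0 < q := by positivity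
  have hu : √(a * ε / M) = (a * ε) / q := by
    rw [hq, show a * ε / M = (a * ε) ^ 2 / (M * (a * ε)) by field_simp, Real.sqrt_div (by positivity),
      Real.sqrt_sq hδ.le]
  have h1 := div_innerAccuracy_le hℓ hρ hM0 hδ (x := κ * √(a * ε / M)) (by positivity)
  have h2 : ℓ * (κ * √(a * ε / M)) / (a * ε) ≤ Λ / a := by
    have e : ℓ * (κ * √(a * ε / M)) / (a * ε) = (ℓ * κ) / q := by rw [hu]; field_simp
    rw [e]
    refine div_sqrt_le hM0 ha ha1 hε (by linarith) ?_
    have f3' : ℓ ^ 2 ≤ Λ * (ρ * ε) := by rwa [div_le_iff₀ (by positivity)] at f3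
    have : κ ^ 2 ≤ κ ^ 3 := pow_le_pow_right₀ hκ (by norm_num)
    calc (ℓ * κ) ^ 2 = ℓ ^ 2 * κ ^ 2 := by ring
      _ ≤ (Λ * (ρ * ε)) * κ ^ 3 := by gcongr
      _ = Λ * (κ ^ 3 * ρ * ε) := by ring
      _ ≤ _ := by gcongr
  have h3 : ρ * (κ * √(a * ε / M)) / q ≤ 1 := by
    have e : ρ * (κ * √(a * ε / M)) / q = κ * ρ / M := by
      have : q ^ 2 = M * (a * ε) := Real.sq_sqrt (by positivity)
      rw [hu]
      field_simp
      rw [this]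
      ring
    rw [e, div_le_one hM0]
    refine le_trans ?_ hM
    gcongr
    exact le_self_pow₀ hκ (by norm_num)
  have h4 : 1 ≤ Λ / a := by rw [le_div_iff₀ ha]; linarith
  have h5 := log_le_of_le_mul_pow (z := 1 + κ * √(a * ε / M) / innerAccuracy ℓ ρ M (a * ε))
    (c := 865) (a := a) (Λ := Λ) 1 (by
      have : 0 < innerAccuracy ℓ ρ M (a * ε) := by unfold innerAccuracy; positivity
      positivity) (by norm_num) ha f6 (by linarith) (by
      have e : 865 / a * Λ = 865 * (Λ / a) := by ring
      rw [pow_one, e]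
      linarith)
  simpa using h5

/-- Both quotients are at most Λ/a, whence 864 = 576 + 288, and √(κ + 1) ≤ Λ supplies the second
power of Λ. -/
theorem log_init_le {κ ℓ ρ ε y a M : ℝ} (hκ : 1 ≤ κ) (hℓ : 0 < ℓ) (hρ : 0 < ρ) (hε : 0 < ε)
    (hy : 0 ≤ y) (ha : 0 < a) (ha1 : a ≤ 1) (hM : κ ^ 3 * ρ ≤ M) :
    Real.log (√(κ + 1) / innerAccuracy ℓ ρ M (a * ε) * y) ≤
      (2 + 864 / a) * Real.log (logArg κ ℓ ρ ε y) := by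
  obtain ⟨f1, -, -, f4, f5, f6⟩ := logArg_facts hκ hℓ hρ hε hy
  have f2 := log_sqrt_le hκ hℓ hρ hε hy
  set Λ := logArg κ ℓ ρ ε y
  have hM0 : 0 < M := lt_of_lt_of_le (by positivity) hM
  have hδ : 0 < a * ε := by positivity
  have he : 0 < innerAccuracy ℓ ρ M (a * ε) := by unfold innerAccuracy; positivity
  have h1 := div_innerAccuracy_le hℓ hρ hM0 hδ hy
  have h2 : ℓ * y / (a * ε) ≤ Λ / a := by
    rw [mul_comm a, ← div_div]
    gcongr
  have h3 : ρ * y / √(M * (a * ε)) ≤ Λ / a := by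
    refine div_sqrt_le hM0 ha ha1 hε (by linarith) ?_
    have f5' : ρ * y ^ 2 ≤ Λ * ε := by rwa [div_le_iff₀ hε] at f5
    have h4 : ρ ≤ M := by
      refine le_trans ?_ hM
      exact le_mul_of_one_le_left hρ.le (one_le_pow₀ hκ)
    calc (ρ * y) ^ 2 = ρ * (ρ * y ^ 2) := by ring
      _ ≤ M * (Λ * ε) := by gcongr
      _ = _ := by ring
  have h5 := log_le_of_le_mul_pow (z := √(κ + 1) / innerAccuracy ℓ ρ M (a * ε) * y)
    (c := 864) (a := a) (Λ := Λ) 2 (by positivity) (by norm_num) ha f6 (by linarith) (by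
      calc _ = √(κ + 1) * (y / innerAccuracy ℓ ρ M (a * ε)) := by ring
        _ ≤ Λ * (576 * (Λ / a) + 288 * (Λ / a)) := by
          gcongr
          linarith
        _ = _ := by ring)
  simpa using h5

/-- Identifies the iteration bound Δ/(M u³), u = √(δ/M), with Δ√M δ^(-3/2). -/
theorem sqrt_mul_rpow_mul {M δ : ℝ} (hM : 0 < M) (hδ : 0 < δ) :
    √M * δ ^ (-(3 / 2) : ℝ) * (M * √(δ / M) ^ 3) = 1 := by
  have e1 : δ ^ (-(3 / 2) : ℝ) = (δ * √δ)⁻¹ := by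
    rw [Real.rpow_neg hδ.le, Real.sqrt_eq_rpow, ← Real.rpow_one_add' hδ.le (by norm_num)]
    norm_num
  have hs1 : 0 < √M := by positivity
  have hs2 : 0 < √δ := by positivity
  have e2 : √M ^ 2 = M := Real.sq_sqrt hM.le
  have e3 : √δ ^ 2 = δ := Real.sq_sqrt hδ.le
  rw [e1, Real.sqrt_div hδ.le]
  generalize √M = p at *
  generalize √δ = q at *
  subst e2 e3
  field_simp

/-- The upper bound for `M`, in terms of `κ`, `d`, `ρ`. -/
theorem M_le {κ ρ d C M : ℝ} {m : ℕ} (hκ : 1 ≤ κ) (hρ : 0 < ρ) (hC : 0 < C)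
    (hm : (m : ℝ) ≤ d / √κ + 2) (hM : M ≤ C * (m * (4 * √2 * κ ^ 3 * ρ))) :
    M ≤ 6 * C * (κ ^ 3 * ρ * (d / √κ + 2)) := by
  have hsq : √2 ≤ 3 / 2 := by rw [Real.sqrt_le_left (by norm_num)]; norm_num
  refine hM.trans ?_
  calc C * (m * (4 * √2 * κ ^ 3 * ρ)) ≤ C * ((d / √κ + 2) * (4 * (3 / 2) * κ ^ 3 * ρ)) := by
        gcongr
        exact (Nat.cast_nonneg m).trans hm
    _ = _ := by ring

/-- After squaring, the factor κ(d/√κ + 2) ≤ 2(κ + √κ d) is at most twice the square of κ^(1/2) +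
κ^(1/4) d^(1/2). -/
theorem sqrt_M_mul_le {κ ρ d C M : ℝ} (hκ : 1 ≤ κ) (hρ : 0 < ρ) (hC : 0 < C) (hd : 0 ≤ d)
    (hM : M ≤ 6 * C * (κ ^ 3 * ρ * (d / √κ + 2))) :
    √κ * √M ≤ √(12 * C) * ((κ ^ (1 / 2 : ℝ) + κ ^ (1 / 4 : ℝ) * d ^ (1 / 2 : ℝ)) *
      κ ^ (3 / 2 : ℝ) * ρ ^ (1 / 2 : ℝ)) := by
  have hκ0 : 0 < κ := by linarith
  rw [← Real.sqrt_mul hκ0.le]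
  refine Real.sqrt_le_left (by positivity) |>.2 ?_
  have e1 : (κ ^ (1 / 2 : ℝ)) ^ 2 = κ := by
    rw [← Real.sqrt_eq_rpow, Real.sq_sqrt hκ0.le]
  have e2 : (κ ^ (1 / 4 : ℝ)) ^ 2 = √κ := by
    rw [← Real.rpow_natCast, ← Real.rpow_mul hκ0.le, Real.sqrt_eq_rpow]; norm_num
  have e3 : (d ^ (1 / 2 : ℝ)) ^ 2 = d := by
    rw [← Real.sqrt_eq_rpow, Real.sq_sqrt hd]
  have e4 : (κ ^ (3 / 2 : ℝ)) ^ 2 = κ ^ 3 := by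
    rw [← Real.rpow_natCast, ← Real.rpow_natCast κ 3, ← Real.rpow_mul hκ0.le]; norm_num
  have e5 : (ρ ^ (1 / 2 : ℝ)) ^ 2 = ρ := by
    rw [← Real.sqrt_eq_rpow, Real.sq_sqrt hρ.le]
  rw [mul_pow, mul_pow, mul_pow, Real.sq_sqrt (by positivity), e4, e5]
  have hZ : κ + √κ * d ≤ (κ ^ (1 / 2 : ℝ) + κ ^ (1 / 4 : ℝ) * d ^ (1 / 2 : ℝ)) ^ 2 := by
    have h0 : 0 ≤ κ ^ (1 / 2 : ℝ) * (κ ^ (1 / 4 : ℝ) * d ^ (1 / 2 : ℝ)) := by positivity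
    calc κ + √κ * d = (κ ^ (1 / 2 : ℝ)) ^ 2 + (κ ^ (1 / 4 : ℝ)) ^ 2 * (d ^ (1 / 2 : ℝ)) ^ 2 := by
          rw [e1, e2, e3]
      _ ≤ _ := by linarith
  have hs : 0 < √κ := by positivity
  have e6 : κ * (d / √κ) = √κ * d := by
    have : √κ ^ 2 = κ := Real.sq_sqrt hκ0.le
    field_simp
    rw [this, mul_comm]
  have hsd : 0 ≤ √κ * d := by positivity
  calc κ * M ≤ κ * (6 * C * (κ ^ 3 * ρ * (d / √κ + 2))) := by gcongr
    _ = 6 * C * κ ^ 3 * ρ * (κ * (d / √κ) + 2 * κ) := by ring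
    _ ≤ 6 * C * κ ^ 3 * ρ * (2 * (κ + √κ * d)) := by
        rw [e6]
        gcongr
        linarith
    _ ≤ 6 * C * κ ^ 3 * ρ * (2 * (κ ^ (1 / 2 : ℝ) + κ ^ (1 / 4 : ℝ) * d ^ (1 / 2 : ℝ)) ^ 2) := by
        gcongr
    _ = _ := by ring

/-- With D = max d √κ, d/√κ + 2 ≤ 3D/√κ, so M ≤ 18C κ^(5/2) ρ D. The bound on a cancels 18C and
determines a₀. -/
theorem sqrt_tolerance_le {κ ρ d C M a ε : ℝ} (hκ : 1 ≤ κ) (hρ : 0 < ρ) (hC : 0 < C) (hε : 0 < ε)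
    (ha : 0 < a) (haC : a ≤ 1 / (18 * C)) (hM : M ≤ 6 * C * (κ ^ 3 * ρ * (d / √κ + 2))) :
    √(M * (a * ε)) ≤ κ ^ (5 / 4 : ℝ) * √(max d (√κ) * ρ * ε) := by
  have hκ0 : 0 < κ := by linarith
  have hs : 0 < √κ := by positivity
  have hD : √κ ≤ max d (√κ) := le_max_right _ _
  have hD' : d ≤ max d (√κ) := le_max_left _ _
  set D := max d (√κ)
  have hD0 : 0 < D := hs.trans_le hD
  refine Real.sqrt_le_left (by positivity) |>.2 ?_
  have e1 : (κ ^ (5 / 4 : ℝ)) ^ 2 = κ ^ 3 / √κ := by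
    rw [← Real.rpow_natCast, ← Real.rpow_natCast κ 3, ← Real.rpow_mul hκ0.le, Real.sqrt_eq_rpow,
      ← Real.rpow_sub hκ0]
    norm_num
  rw [mul_pow, e1, Real.sq_sqrt (by positivity)]
  have h1 : d / √κ + 2 ≤ 3 * (D / √κ) := by
    have h2 : d / √κ ≤ D / √κ := by gcongr
    have h3 : 1 ≤ D / √κ := by rwa [le_div_iff₀ hs, one_mul]
    linarith
  calc M * (a * ε) ≤ (6 * C * (κ ^ 3 * ρ * (3 * (D / √κ)))) * (1 / (18 * C) * ε) := by
        gcongr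
        exact hM.trans (by gcongr)
    _ = _ := by field_simp; ring

theorem rpow_add_le {κ d : ℝ} (hκ : 0 ≤ κ) (hd : 0 ≤ d) :
    κ ^ (1 / 2 : ℝ) + κ ^ (1 / 4 : ℝ) * d ^ (1 / 2 : ℝ) ≤ 3 / 2 * (κ ^ (1 / 2 : ℝ) + d) := by
  have e1 : (κ ^ (1 / 4 : ℝ)) ^ 2 = κ ^ (1 / 2 : ℝ) := by
    rw [← Real.rpow_natCast, ← Real.rpow_mul hκ]; norm_num
  have e2 : (d ^ (1 / 2 : ℝ)) ^ 2 = d := by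
    rw [← Real.sqrt_eq_rpow, Real.sq_sqrt hd]
  have h := two_mul_le_add_sq (κ ^ (1 / 4 : ℝ)) (d ^ (1 / 2 : ℝ))
  rw [e1, e2] at h
  have : 0 ≤ κ ^ (1 / 2 : ℝ) := by positivity
  linarith

end Numerics

end LMCN

/-! ### Choice of constants and assembly. -/

theorem theorem4p7 :
    ∃ c : ℝ, 0 < c ∧ ∀ C : ℝ, c ≤ C → ∃ a₀ : ℝ, 0 < a₀ ∧ a₀ ≤ 1 ∧
    ∀ a : ℝ, 0 < a → a ≤ 1 → ∃ B : ℝ, 0 < B ∧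
    ∀ (p q : ℕ) (f : LMCN.Joint (LMCN.Vec p) (LMCN.Vec q) → ℝ) (x₀ : LMCN.Vec p) (μ ℓ ρ N ε : ℝ),
      0 < p → 0 < q → 0 < μ → 0 < ρ → 0 < N → 0 < ε →
      LMCN.Assumptions f μ ℓ ρ →
    ∀ (d κ ρbar Δ M : ℝ) (m T : ℕ),
      d = max (p : ℝ) (q : ℝ) →
      κ = ℓ / μ →
      ρbar = 4 * √2 * κ ^ 3 * ρ →
      Δ = LMCN.primal f x₀ - ⨅ x, LMCN.primal f x →
      |(m : ℝ) - (d / √κ + 1)| ≤ 1 →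
      c * (m * ρbar) ≤ M → M ≤ C * (m * ρbar) →
      c * (Δ * √M * (a * ε) ^ (-(3 / 2) : ℝ)) < T →
      (∃ (K : ℕ → ℕ) (σ : ℕ → LMCN.State (LMCN.Vec p) (LMCN.Vec q)) (n : ℕ),
        LMCN.IsRun f ⟨x₀, T, K, κ, ℓ, a * ε, m, M, ρbar⟩ σ n ∧
        LMCN.IsSchedule f κ (LMCN.innerAccuracy ℓ ρ M (a * ε)) K σ n) ∧
      (∀ (K : ℕ → ℕ) (σ : ℕ → LMCN.State (LMCN.Vec p) (LMCN.Vec q)) (n : ℕ),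
        LMCN.IsRun f ⟨x₀, T, K, κ, ℓ, a * ε, m, M, ρbar⟩ σ n →
        LMCN.IsSchedule f κ (LMCN.innerAccuracy ℓ ρ M (a * ε)) K σ n →
        LMCN.IsSOSP (LMCN.primal f) (a * ε) (√(M * (a * ε))) (σ n).x ∧
        (a ≤ a₀ → LMCN.IsSOSP (LMCN.primal f) ε
          (κ ^ (5 / 4 : ℝ) * √(max d (√κ) * ρ * ε)) (σ n).x) ∧
        LMCN.cost N d (σ n) ≤
          B * (N * (Δ * (κ ^ (1 / 2 : ℝ) + κ ^ (1 / 4 : ℝ) * d ^ (1 / 2 : ℝ)) *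
              κ ^ (3 / 2 : ℝ) * ρ ^ (1 / 2 : ℝ) * ε ^ (-(3 / 2) : ℝ) + κ ^ (1 / 2 : ℝ) + d)) *
            Real.log (2 + κ + ℓ ^ 2 / (ρ * ε) + ℓ * ‖LMCN.yStar f x₀‖ / ε +
              ρ * ‖LMCN.yStar f x₀‖ ^ 2 / ε)) ∧
      κ ^ (1 / 2 : ℝ) + κ ^ (1 / 4 : ℝ) * d ^ (1 / 2 : ℝ) ≤
        3 / 2 * (κ ^ (1 / 2 : ℝ) + d) := by
  refine ⟨10000, by norm_num, fun C hC => ⟨1 / (18 * C), by positivity, ?_, ?_⟩⟩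
  · rw [div_le_one (by linarith)]; linarith
  intro a ha ha1
  have hC0 : 0 < C := by linarith
  set c₁ : ℝ := √(12 * C) * a ^ (-(3 / 2) : ℝ) with hc₁
  have hc₁0 : 0 < c₁ := by positivity
  -- B is the sum of the three coefficients in `cost_le` with γ = 2 + 864/a and β = 1 + 865/a; c₁
  -- converts √κ W into the stated expression.
  refine ⟨2 + 2 * (2 + 864 / a) + 4 + (416 + 80 * (1 + 865 / a)) * c₁, by positivity, ?_⟩
  intro p q f x₀ μ ℓ ρ N ε hp hq hμ hρ hN hε hf d κ ρbar Δ M m T hd hκ hρbar hΔ hm hM hMC hT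
  have : Nonempty (Fin p) := ⟨⟨0, hp⟩⟩
  have : Nonempty (Fin q) := ⟨⟨0, hq⟩⟩
  have hℓμ := hf.le_lipschitz
  have hℓ : 0 < ℓ := hμ.trans_le hℓμ
  have hκ1 : 1 ≤ κ := by rw [hκ, le_div_iff₀ hμ, one_mul]; exact hℓμ
  have hs0 : 0 < √κ := Real.sqrt_pos.2 (by linarith)
  have hd0 : 0 < d := by
    rw [hd]; exact lt_max_of_lt_left (by exact_mod_cast hp)
  obtain ⟨hm1, hm2⟩ := abs_le.1 hm
  -- The offset 1 in the target for m equals the rounding tolerance, so d/√κ ≤ m ≤ d/√κ + 2. The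
  -- lower bound gives m ≥ 1 and the snapshot cost, the upper one the bound on M.
  have hmd : d / √κ ≤ m := by linarith
  have hm0 : 0 < m := by
    have h1 : 0 < d / √κ := by positivity
    exact_mod_cast h1.trans_le hmd
  have hρbar0 : 0 < ρbar := by rw [hρbar]; positivity
  have hM0 : 0 < M := lt_of_lt_of_le (by positivity) hM
  have hδ : 0 < a * ε := by positivity
  have hΔ0 : 0 ≤ Δ := by
    rw [hΔ, sub_nonneg]; exact ciInf_le hf.bddBelow x₀
  set W := Δ * √M * (a * ε) ^ (-(3 / 2) : ℝ) with hW
  have hW0 : 0 ≤ W := by positivity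
  have hT0 : (0 : ℝ) < T := lt_of_le_of_lt (by positivity) hT
  have hWΔ : W * (M * √(a * ε / M) ^ 3) = Δ := by
    rw [hW, mul_assoc Δ, mul_assoc Δ, LMCN.sqrt_mul_rpow_mul hM0 hδ, mul_one]
  have hMκ : κ ^ 3 * ρ ≤ M := by
    have h1 : (1 : ℝ) ≤ m := by exact_mod_cast hm0
    have h2 : 7 / 5 ≤ √2 := Real.le_sqrt_of_sq_le (by norm_num)
    have h3 : 0 ≤ κ ^ 3 * ρ := by positivity
    have h4 : κ ^ 3 * ρ ≤ ρbar := by rw [hρbar]; nlinarith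
    nlinarith
  have hM6 := LMCN.M_le hκ1 hρ hC0 (by linarith : (m : ℝ) ≤ d / √κ + 2) (hρbar ▸ hMC)
  refine ⟨LMCN.exists_run f x₀ (by exact_mod_cast hT0) κ ℓ (a * ε) m hM0 ρbar _, ?_,
    LMCN.rpow_add_le (by linarith) hd0.le⟩
  intro K σ n hrun hsched
  have h : LMCN.Setting f μ ℓ ρ ⟨x₀, T, K, κ, ℓ, a * ε, m, M, ρbar⟩ σ n :=
    ⟨hf, hμ, hρ, hκ, rfl, by rw [hρbar, hκ], hδ, hm0, hM, hrun, hsched⟩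
  have hu : 0 < M * √(a * ε / M) ^ 3 := by positivity
  have hlast := h.stops_last (by
    change 40 * (LMCN.primal f x₀ - ⨅ x, LMCN.primal f x) < T * (M * √(a * ε / M) ^ 3)
    rw [← hΔ, ← hWΔ, ← mul_assoc]
    refine mul_lt_mul_of_pos_right ?_ hu
    linarith)
  have hn : n - 1 + 1 = n := Nat.sub_add_cancel hrun.pos
  obtain ⟨s1, s2⟩ := h.stationary (t := n - 1) (by omega) (by rwa [hn])
  rw [hn] at s1 s2
  have hsosp := hf.isSOSP hμ s1 s2
  refine ⟨hsosp, fun haC => hsosp.mono ?_ ?_, ?_⟩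
  · exact mul_le_of_le_one_left hε.le ha1
  · exact LMCN.sqrt_tolerance_le hκ1 hρ hC0 hε ha haC hM6
  · have hy := norm_nonneg (LMCN.yStar f x₀)
    obtain ⟨-, -, -, -, -, hL⟩ := LMCN.logArg_facts hκ1 hℓ hρ hε hy
    set Lg := Real.log (LMCN.logArg κ ℓ ρ ε ‖LMCN.yStar f x₀‖) with hLg
    have hcost := h.cost_le (N := N) (d := d) (W := W) (Lg := Lg) (β := 1 + 865 / a)
      (γ := 2 + 864 / a) hN.le hd0.le
      (by rw [← hκ, mul_comm]; exact (div_le_iff₀ hs0).1 hmd) hL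
      (by positivity) (by positivity) (hWΔ.trans hΔ)
      (by
        rw [← hκ]
        exact Real.log_le_log (by positivity) (LMCN.log_sqrt_le hκ1 hℓ hρ hε hy))
      (by rw [← hκ]; exact LMCN.log_step_le hκ1 hℓ hρ hε hy ha ha1 hMκ)
      (by rw [← hκ]; exact LMCN.log_init_le hκ1 hℓ hρ hε hy ha ha1 hMκ)
    refine hcost.trans ?_
    rw [← hκ]
    change _ ≤ _ * Lg
    set X := Δ * (κ ^ (1 / 2 : ℝ) + κ ^ (1 / 4 : ℝ) * d ^ (1 / 2 : ℝ)) *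
      κ ^ (3 / 2 : ℝ) * ρ ^ (1 / 2 : ℝ) * ε ^ (-(3 / 2) : ℝ) with hX
    have hX0 : 0 ≤ X := by positivity
    have hWX : √κ * W ≤ c₁ * X := by
      rw [hW, hX, hc₁, Real.mul_rpow ha.le hε.le]
      have h1 := LMCN.sqrt_M_mul_le hκ1 hρ hC0 hd0.le hM6
      calc _ = (√κ * √M) * (Δ * (a ^ (-(3 / 2) : ℝ) * ε ^ (-(3 / 2) : ℝ))) := by ring
        _ ≤ _ := mul_le_mul_of_nonneg_right h1 (by positivity)
        _ = _ := by ring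
    rw [← Real.sqrt_eq_rpow]
    generalize √κ = s at *
    refine mul_le_mul_of_nonneg_right ?_ (zero_le_one.trans hL)
    rw [mul_left_comm _ N]
    refine mul_le_mul_of_nonneg_left ?_ hN.le
    have hγ : 0 < 2 + 864 / a := by positivity
    have hβ : 0 < 416 + 80 * (1 + 865 / a) := by positivity
    generalize 2 + 864 / a = γ at *
    generalize 416 + 80 * (1 + 865 / a) = β at *
    calc (2 + 2 * γ) * s + 4 * d + β * (s * W) ≤ (2 + 2 * γ) * s + 4 * d + β * (c₁ * X) := by
          gcongr
      -- The missing nonnegative cross terms are added so that the sum factors as B times X + s + d.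
      _ ≤ (2 + 2 * γ) * s + 4 * d + β * (c₁ * X) +
          ((2 + 2 * γ) * (X + d) + 4 * (X + s) + β * c₁ * (s + d)) :=
          le_add_of_nonneg_right (by positivity)
      _ = _ := by ring
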